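/- Let $\mathcal{E}$ be an exact category in the sense of Quillen, $\mathcal{M}\subseteq\mathcal{E}$ a full additive subcategory and $k\ge 1$ an integer. Write $\mathcal{M}\text{-}\mathrm{Mod}$ (resp. $\mathrm{Mod}\text{-}\mathcal{M}$) for the abelian category of covariant (resp. contravariant) additive functors from $\mathcal{M}$ to abelian groups, and $\Psi(Z)=\mathrm{Hom}_{\mathcal{E}}(Z,-)|_{\mathcal{M}}\in\mathcal{M}\text{-}\mathrm{Mod}$, $\Phi(Z)=\mathrm{Hom}_{\mathcal{E}}(-,Z)|_{\mathcal{M}}\in\mathrm{Mod}\text{-}\mathcal{M}$. Let $\mathrm{Ext}^i_{\mathcal{E}}(Y,X)$ be the Yoneda extension groups of $\mathcal{E}$ (classes of exact sequences $0\to X\to E_i\to\cdots\to E_1\to Y\to 0$, and $\mathrm{Hom}_{\mathcal{E}}(Y,X)$ for $i=0$). Let $\mathrm{cogen}^k_{\mathcal{E}}(\mathcal{M})$ be the full subcategory of the objects $X$ for which there is an exact sequence $0\to X\to M_0\to\cdots\to M_k\to Z\to 0$ in $\mathcal{E}$ with all $M_j\in\mathcal{M}$ such that $\mathrm{Hom}(M_k,M)\to\cdots\to\mathrm{Hom}(M_0,M)\to\mathrm{Hom}(X,M)\to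 0$ is exact for every $M\in\mathcal{M}$. Let $\mathrm{gen}_k^{\mathcal{E}}(\mathcal{M})$ be the full subcategory of the objects $Y$ for which there is an exact sequence $0\to Z\to M_k\to\cdots\to M_0\to Y\to 0$ in $\mathcal{E}$ with all $M_j\in\mathcal{M}$ such that $\mathrm{Hom}(M,M_k)\to\cdots\to\mathrm{Hom}(M,M_0)\to\mathrm{Hom}(M,Y)\to 0$ is exact for every $M\in\mathcal{M}$. (a) For $X\in\mathrm{cogen}^k_{\mathcal{E}}(\mathcal{M})$, all $Y$ with $\mathrm{Ext}^i_{\mathcal{E}}(Y,M)=0$ for all $M\in\mathcal{M}$ and $1\le i<k$, and $0\le i<k$, the functor $\Psi$ induces a well-defined isomorphism of abelian groups $$\mathrm{Ext}^i_{\mathcal{E}}(Y,X)\to\mathrm{Ext}^i_{\mathcal{M}\text{-}\mathrm{Mod}}(\Psi(X),\Psi(Y)),$$ natural in such $X$ and $Y$. (b) For $Y\in\mathrm{gen}_k^{\mathcal{E}}(\mathcal{M})$, all $X$ with $\mathrm{Ext}^i_{\mathcal{E}}(M,X)=0$ for all $M\in\mathcal{M}$ and $1\le i<k$, and $0\le i<k$,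 the functor $\Phi$ induces a well-defined isomorphism of abelian groups $$\mathrm{Ext}^i_{\mathcal{E}}(Y,X)\to\mathrm{Ext}^i_{\mathrm{Mod}\text{-}\mathcal{M}}(\Phi(Y),\Phi(X)),$$ natural in such $X$ and $Y$. Here "induces a well-defined isomorphism" means: every class in $\mathrm{Ext}^i_{\mathcal{E}}(Y,X)$ is represented by an $i$-fold extension (a morphism if $i=0$) whose image under $\Psi$ (resp. $\Phi$) is exact, and the isomorphism sends the class to the class of the image of any such representative. -/

import Mathlib

open CategoryTheory CategoryTheory.Limits
universe w v u v' u'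

namespace AddModule
section
variable {A : Type u} [Category.{v} A] [Preadditive A]

instance isClosedUnderLimitsOfShape (J : Type) [SmallCategory J] :
    (additiveFunctor A AddCommGrpCat.{v}).IsClosedUnderLimitsOfShape J where
  limitsOfShape_le := by
    rintro F ⟨h⟩
    refine ⟨fun {X Y f g} => ?_⟩
    have hl := isLimitOfPreserves ((evaluation A AddCommGrpCat.{v}).obj Y) h.isLimit
    refine hl.hom_ext fun j => ?_
    have hj : (h.diag.obj j).Additive := h.prop_diag_obj j
    change F.map (f + g) ≫ (h.π.app j).app Y = (F.map f + F.map g) ≫ (h.π.app j).app Y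
    rw [Preadditive.add_comp]
    have e := fun t : X ⟶ Y => (h.π.app j).naturality t
    dsimp at e
    rw [e, e, e, (h.diag.obj j).map_add, Preadditive.comp_add]

instance isClosedUnderColimitsOfShape (J : Type) [SmallCategory J] :
    (additiveFunctor A AddCommGrpCat.{v}).IsClosedUnderColimitsOfShape J where
  colimitsOfShape_le := by
    rintro F ⟨h⟩
    refine ⟨fun {X Y f g} => ?_⟩
    have hl := isColimitOfPreserves ((evaluation A AddCommGrpCat.{v}).obj X) h.isColimit
    refine hl.hom_ext fun j => ?_
    have hj : (h.diag.obj j).Additive := h.prop_diag_obj j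
    change (h.ι.app j).app X ≫ F.map (f + g) = (h.ι.app j).app X ≫ (F.map f + F.map g)
    rw [Preadditive.comp_add]
    have e := fun t : X ⟶ Y => (h.ι.app j).naturality t
    dsimp at e
    rw [← e, ← e, ← e, (h.diag.obj j).map_add, Preadditive.add_comp]

instance : (additiveFunctor A AddCommGrpCat.{v}).IsClosedUnderKernels where
  kernels_le := by
    rintro _ ⟨f, k, hk, hf⟩
    refine ObjectProperty.prop_of_isLimit _ hk ?_
    rintro (_ | _)
    exacts [hf.1, hf.2]

instance : (additiveFunctor A AddCommGrpCat.{v}).IsClosedUnderCokernels where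
  cokernels_le := by
    rintro _ ⟨f, k, hk, hf⟩
    refine ObjectProperty.prop_of_isColimit _ hk ?_
    rintro (_ | _)
    exacts [hf.1, hf.2]

instance : (additiveFunctor A AddCommGrpCat.{v}).IsClosedUnderFiniteProducts where

instance : (additiveFunctor A AddCommGrpCat.{v}).ContainsZero where
  exists_zero := by
    refine ⟨_, isZero_zero (A ⥤ AddCommGrpCat.{v}), ⟨fun {X Y f g} => ?_⟩⟩
    exact ((isZero_zero (A ⥤ AddCommGrpCat.{v})).obj X).eq_of_src _ _

/-- The category of additive functors from `A` to abelian groups is abelian, with the structure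
induced by that of all functors. -/
noncomputable instance : Abelian (A ⥤+ AddCommGrpCat.{v}) := inferInstance

instance : HasExt.{max u (v+1)} (A ⥤+ AddCommGrpCat.{v}) := HasExt.standard _
end
end AddModule

section Exact
variable {C : Type u} [Category.{v} C] [Preadditive C]

/-- A morphism is an inflation if it is the first morphism of a distinguished short complex. -/
def IsInflationFor (K : ObjectProperty (ShortComplex C)) {A B : C} (i : A ⟶ B) : Prop :=
  ∃ (Z : C) (p : B ⟶ Z) (w : i ≫ p = 0), K (ShortComplex.mk i p w)

/-- A morphism is a deflation if it is the second morphism of a distinguished short complex. -/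
def IsDeflationFor (K : ObjectProperty (ShortComplex C)) {B Z : C} (p : B ⟶ Z) : Prop :=
  ∃ (A : C) (i : A ⟶ B) (w : i ≫ p = 0), K (ShortComplex.mk i p w)

variable (C) in
/-- An exact structure in the sense of Quillen on an additive category: a class of kernel-cokernel
pairs, called conflations. -/
structure ExactStructure where
  /-- the conflations `A ⟶ B ⟶ Z` -/
  conflation : ObjectProperty (ShortComplex C)
  conflation_of_iso : ∀ {S T : ShortComplex C}, (S ≅ T) → conflation S → conflation T
  isKernel : ∀ S : ShortComplex C, conflation S → Nonempty (IsLimit (KernelFork.ofι S.f S.zero))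
  isCokernel : ∀ S : ShortComplex C, conflation S →
    Nonempty (IsColimit (CokernelCofork.ofπ S.g S.zero))
  inflation_id : ∀ A : C, IsInflationFor conflation (𝟙 A)
  deflation_id : ∀ A : C, IsDeflationFor conflation (𝟙 A)
  inflation_comp : ∀ {A B D : C} (i : A ⟶ B) (j : B ⟶ D),
    IsInflationFor conflation i → IsInflationFor conflation j → IsInflationFor conflation (i ≫ j)
  deflation_comp : ∀ {A B D : C} (p : A ⟶ B) (q : B ⟶ D),
    IsDeflationFor conflation p → IsDeflationFor conflation q → IsDeflationFor conflation (p ≫ q)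
  /-- the push-out of an inflation along any morphism exists and is an inflation -/
  inflation_pushout : ∀ {A B A' : C} (i : A ⟶ B) (f : A ⟶ A'), IsInflationFor conflation i →
    ∃ (B' : C) (f' : B ⟶ B') (i' : A' ⟶ B'), IsPushout i f f' i' ∧ IsInflationFor conflation i'
  /-- the pull-back of a deflation along any morphism exists and is a deflation -/
  deflation_pullback : ∀ {B Z Z' : C} (p : B ⟶ Z) (f : Z' ⟶ Z), IsDeflationFor conflation p →
    ∃ (B' : C) (f' : B' ⟶ B) (p' : B' ⟶ Z'), IsPullback f' p' p f ∧ IsDeflationFor conflation p'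

namespace ExactStructure

variable (𝓔 : ExactStructure C)

/-- `A ⟶ B ⟶ Z` is a conflation. -/
def IsConflation {A B Z : C} (i : A ⟶ B) (p : B ⟶ Z) : Prop :=
  ∃ w : i ≫ p = 0, 𝓔.conflation (ShortComplex.mk i p w)

variable {𝓔}

namespace IsConflation

variable {A B Z : C} {i : A ⟶ B} {p : B ⟶ Z}

lemma zero (h : 𝓔.IsConflation i p) : i ≫ p = 0 := h.1

lemma mono (h : 𝓔.IsConflation i p) : Mono i := by
  obtain ⟨hl⟩ := 𝓔.isKernel _ h.2
  exact mono_of_isLimit_fork hl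

lemma epi (h : 𝓔.IsConflation i p) : Epi p := by
  obtain ⟨hl⟩ := 𝓔.isCokernel _ h.2
  exact epi_of_isColimit_cofork hl

lemma exists_lift (h : 𝓔.IsConflation i p) {T : C} (f : T ⟶ B) (hf : f ≫ p = 0) :
    ∃ g : T ⟶ A, g ≫ i = f := by
  obtain ⟨hl⟩ := 𝓔.isKernel _ h.2
  exact ⟨hl.lift (KernelFork.ofι f hf), hl.fac _ WalkingParallelPair.zero⟩

lemma exists_desc (h : 𝓔.IsConflation i p) {T : C} (f : B ⟶ T) (hf : i ≫ f = 0) :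
    ∃ g : Z ⟶ T, p ≫ g = f := by
  obtain ⟨hl⟩ := 𝓔.isCokernel _ h.2
  exact ⟨hl.desc (CokernelCofork.ofπ f hf), hl.fac _ WalkingParallelPair.one⟩

lemma of_iso (h : 𝓔.IsConflation i p) {A' B' Z' : C} {i' : A' ⟶ B'} {p' : B' ⟶ Z'}
    (e₁ : A ≅ A') (e₂ : B ≅ B') (e₃ : Z ≅ Z') (h₁ : i ≫ e₂.hom = e₁.hom ≫ i')
    (h₂ : p ≫ e₃.hom = e₂.hom ≫ p') : 𝓔.IsConflation i' p' := by
  have w : i' ≫ p' = 0 := by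
    rw [← cancel_epi e₁.hom, ← reassoc_of% h₁, ← h₂, reassoc_of% h.zero, zero_comp, comp_zero]
  exact ⟨w, 𝓔.conflation_of_iso (S := ShortComplex.mk i p h.zero) (T := ShortComplex.mk i' p' w)
    (ShortComplex.isoMk e₁ e₂ e₃ h₁.symm h₂.symm) h.2⟩

/-- An inflation and any cokernel of it form a conflation. -/
lemma of_cokernel {B' Z' : C} {j : A ⟶ B'} {q : B' ⟶ Z'} (hj : IsInflationFor 𝓔.conflation j)
    (w : j ≫ q = 0) (hq : Epi q)
    (hd : ∀ {T : C} (f : B' ⟶ T), j ≫ f = 0 → ∃ g : Z' ⟶ T, q ≫ g = f) :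
    𝓔.IsConflation j q := by
  obtain ⟨Z₀, q₀, w₀, h₀⟩ := hj
  have H : 𝓔.IsConflation j q₀ := ⟨w₀, h₀⟩
  have := H.epi
  obtain ⟨a, ha⟩ := hd q₀ w₀
  obtain ⟨b, hb⟩ := H.exists_desc q w
  let e : Z₀ ≅ Z' := ⟨b, a, by rw [← cancel_epi q₀, reassoc_of% hb, ha, Category.comp_id],
    by rw [← cancel_epi q, reassoc_of% ha, hb, Category.comp_id]⟩
  exact H.of_iso (Iso.refl _) (Iso.refl _) e (by simp) (by simp [e, hb])

/-- A deflation and any kernel of it form a conflation. -/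
lemma of_kernel {A' B' : C} {j : A' ⟶ B'} {q : B' ⟶ Z} (hq : IsDeflationFor 𝓔.conflation q)
    (w : j ≫ q = 0) (hj : Mono j)
    (hd : ∀ {T : C} (f : T ⟶ B'), f ≫ q = 0 → ∃ g : T ⟶ A', g ≫ j = f) :
    𝓔.IsConflation j q := by
  obtain ⟨A₀, j₀, w₀, h₀⟩ := hq
  have H : 𝓔.IsConflation j₀ q := ⟨w₀, h₀⟩
  have := H.mono
  obtain ⟨a, ha⟩ := hd j₀ w₀
  obtain ⟨b, hb⟩ := H.exists_lift j w
  let e : A₀ ≅ A' := ⟨a, b, by rw [← cancel_mono j₀, Category.assoc, hb, ha, Category.id_comp],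
    by rw [← cancel_mono j, Category.assoc, ha, hb, Category.id_comp]⟩
  exact H.of_iso e (Iso.refl _) (Iso.refl _) (by simp [e, ha]) (by simp)

lemma exists_pushout (h : 𝓔.IsConflation i p) {A' : C} (f : A ⟶ A') :
    ∃ (B' : C) (f' : B ⟶ B') (i' : A' ⟶ B') (p' : B' ⟶ Z),
      IsPushout i f f' i' ∧ 𝓔.IsConflation i' p' ∧ f' ≫ p' = p := by
  obtain ⟨B', f', i', sq, hi'⟩ := 𝓔.inflation_pushout i f ⟨_, p, h.1, h.2⟩
  refine ⟨B', f', i', sq.desc p 0 (by simp [h.zero]), sq, ?_, by simp⟩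
  have := h.epi
  refine of_cokernel hi' (by simp) ?_ ?_
  · have : Epi (f' ≫ sq.desc p 0 (by simp [h.zero])) := by simpa
    exact epi_of_epi f' _
  · intro T g hg
    obtain ⟨k, hk⟩ := h.exists_desc (f' ≫ g) (by rw [sq.w_assoc, hg, comp_zero])
    exact ⟨k, sq.hom_ext (by simp [hk]) (by simp [hg])⟩

lemma exists_pullback (h : 𝓔.IsConflation i p) {Z' : C} (f : Z' ⟶ Z) :
    ∃ (B' : C) (f' : B' ⟶ B) (i' : A ⟶ B') (p' : B' ⟶ Z'),
      IsPullback f' p' p f ∧ 𝓔.IsConflation i' p' ∧ i' ≫ f' = i := by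
  obtain ⟨B', f', p', sq, hp'⟩ := 𝓔.deflation_pullback p f ⟨_, i, h.1, h.2⟩
  refine ⟨B', f', sq.lift i 0 (by simp [h.zero]), p', sq, ?_, by simp⟩
  have := h.mono
  refine of_kernel hp' (by simp) ?_ ?_
  · have : Mono (sq.lift i 0 (by simp [h.zero]) ≫ f') := by simpa
    exact mono_of_mono _ f'
  · intro T g hg
    obtain ⟨k, hk⟩ := h.exists_lift (g ≫ f') (by rw [Category.assoc, sq.w, reassoc_of% hg, zero_comp])
    exact ⟨k, sq.hom_ext (by simp [hk]) (by simp [hg])⟩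

variable [HasBinaryBiproducts C]

lemma isPushout_biprod_map (i : A ⟶ B) (A' : C) :
    IsPushout i (biprod.inl : A ⟶ A ⊞ A') (biprod.inl : B ⟶ B ⊞ A') (biprod.map i (𝟙 A')) := by
  refine ⟨⟨by simp⟩, ⟨PushoutCocone.IsColimit.mk _
    (fun s => biprod.desc s.inl (biprod.inr ≫ s.inr)) (by simp) ?_ ?_⟩⟩
  · intro s
    ext
    · simpa using s.condition
    · simp
  · intro s m h₁ h₂
    ext
    · simpa using h₁
    · simp [← h₂]

lemma biprod_map (h : 𝓔.IsConflation i p) {A' B' Z' : C} {i' : A' ⟶ B'} {p' : B' ⟶ Z'}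
    (h' : 𝓔.IsConflation i' p') : 𝓔.IsConflation (biprod.map i i') (biprod.map p p') := by
  have key : ∀ {A B Z : C} {i : A ⟶ B} {p : B ⟶ Z} (_ : 𝓔.IsConflation i p) (D : C),
      IsInflationFor 𝓔.conflation (biprod.map i (𝟙 D)) := by
    intro A B Z i p h D
    obtain ⟨Q, f', j, q, sq, hj, _⟩ := h.exists_pushout (biprod.inl : A ⟶ A ⊞ D)
    let e := sq.isoIsPushout _ _ (isPushout_biprod_map i D)
    exact ⟨Z, e.inv ≫ q, hj.of_iso (Iso.refl _) e (Iso.refl _) (by simp [e]) (by simp)⟩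
  have h₁ : IsInflationFor 𝓔.conflation (biprod.map i (𝟙 A')) := key h A'
  have h₂ : IsInflationFor 𝓔.conflation (biprod.map (𝟙 B) i') := by
    obtain ⟨Z₀, q, w, hq⟩ := key h' B
    have hq' : 𝓔.IsConflation (biprod.map i' (𝟙 B)) q := ⟨w, hq⟩
    exact ⟨Z₀, (biprod.braiding B' B).inv ≫ q, hq'.of_iso (biprod.braiding _ _)
      (biprod.braiding _ _) (Iso.refl _) (by ext <;> simp) (by simp)⟩
  have h₃ := 𝓔.inflation_comp _ _ h₁ h₂
  have e : biprod.map i (𝟙 A') ≫ biprod.map (𝟙 B) i' = biprod.map i i' := by ext <;> simp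
  rw [e] at h₃
  have := h.epi
  have := h'.epi
  refine of_cokernel h₃ (by ext <;> simp [h.zero, h'.zero]) ?_ ?_
  · refine ⟨fun a b hab => ?_⟩
    have e₁ := biprod.inl ≫= hab
    have e₂ := biprod.inr ≫= hab
    simp only [biprod.inl_map_assoc, biprod.inr_map_assoc, cancel_epi] at e₁ e₂
    ext
    exacts [e₁, e₂]
  · intro T f hf
    obtain ⟨a, ha⟩ := h.exists_desc (biprod.inl ≫ f) (by simpa using biprod.inl ≫= hf)
    obtain ⟨b, hb⟩ := h'.exists_desc (biprod.inr ≫ f) (by simpa using biprod.inr ≫= hf)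
    exact ⟨biprod.desc a b, by ext <;> simp [ha, hb]⟩

end IsConflation

variable (𝓔) in
lemma isConflation_zero_id {O : C} (hO : IsZero O) (Y : C) :
    𝓔.IsConflation (0 : O ⟶ Y) (𝟙 Y) := by
  refine IsConflation.of_kernel (𝓔.deflation_id Y) (by simp) ⟨fun a b _ => hO.eq_of_tgt _ _⟩ ?_
  intro T f hf
  exact ⟨0, by simpa using hf.symm⟩

variable (𝓔) in
lemma isConflation_split [HasZeroObject C] [HasBinaryBiproducts C] (X Y : C) :
    𝓔.IsConflation (biprod.inl : X ⟶ X ⊞ Y) (biprod.snd : X ⊞ Y ⟶ Y) := by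
  have h := 𝓔.isConflation_zero_id (isZero_zero C) Y
  obtain ⟨B', f', i', p', sq, hc, hp⟩ := h.exists_pushout (0 : _ ⟶ X)
  refine IsConflation.of_cokernel ?_ (by simp) inferInstance ?_
  · let a : X ⊞ Y ⟶ B' := biprod.desc i' f'
    let b : B' ⟶ X ⊞ Y := sq.desc biprod.inr biprod.inl (by simp)
    let e : B' ≅ X ⊞ Y := ⟨b, a, by apply sq.hom_ext <;> simp [a, b],
      by ext <;> simp [a, b]⟩
    exact ⟨Y, e.inv ≫ p', hc.of_iso (Iso.refl _) e (Iso.refl _) (by simp [e, b]) (by simp)⟩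
  · intro T f hf
    exact ⟨biprod.inr ≫ f, by ext <;> simp [hf]⟩

variable (𝓔)

/-- An `n`-fold Yoneda extension of `Y` by `X`: for `n = 0` a morphism `Y ⟶ X`, and for `n ≥ 1` an
exact sequence `0 ⟶ X ⟶ Eₙ ⟶ ⋯ ⟶ E₁ ⟶ Y ⟶ 0`, that is, `n` conflations
`X ⟶ Eₙ ⟶ Zₙ₋₁`, ..., `Z₁ ⟶ E₁ ⟶ Y` spliced together. -/
inductive YonedaExtension (X : C) : ℕ → C → Type (max u v)
  | hom {Y : C} (f : Y ⟶ X) : YonedaExtension X 0 Y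
  | single {E Y : C} (i : X ⟶ E) (p : E ⟶ Y) (h : 𝓔.IsConflation i p) : YonedaExtension X 1 Y
  | splice {n : ℕ} {Z E Y : C} (i : Z ⟶ E) (p : E ⟶ Y) (h : 𝓔.IsConflation i p)
      (ξ : YonedaExtension X (n + 1) Z) : YonedaExtension X (n + 2) Y

variable {𝓔}

namespace YonedaExtension

/-- There is a morphism of `n`-fold extensions, i.e. a commutative diagram
```
0 ⟶ X  ⟶ Eₙ  ⟶ ⋯ ⟶ E₁  ⟶ Y  ⟶ 0
    |α    |          |     |β
0 ⟶ X' ⟶ Eₙ' ⟶ ⋯ ⟶ E₁' ⟶ Y' ⟶ 0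
```
with the prescribed morphisms `α` and `β` at the ends. -/
def HasMor {X X' : C} (α : X ⟶ X') : {n : ℕ} → {Y Y' : C} →
    𝓔.YonedaExtension X n Y → 𝓔.YonedaExtension X' n Y' → (Y ⟶ Y') → Prop
  | _, _, _, .hom f, .hom f', β => f ≫ α = β ≫ f'
  | _, _, _, .single (E := E) i p _, .single (E := E') i' p' _, β =>
      ∃ γ : E ⟶ E', i ≫ γ = α ≫ i' ∧ p ≫ β = γ ≫ p'
  | _, _, _, .splice (Z := Z) (E := E) i p _ ξ, .splice (Z := Z') (E := E') i' p' _ ξ', β =>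
      ∃ (ζ : Z ⟶ Z') (γ : E ⟶ E'), i ≫ γ = ζ ≫ i' ∧ p ≫ β = γ ≫ p' ∧ HasMor α ξ ξ' ζ

lemma HasMor.id {X : C} {n : ℕ} {Y : C} (ξ : 𝓔.YonedaExtension X n Y) :
    HasMor (𝟙 X) ξ ξ (𝟙 Y) := by
  induction ξ with
  | hom f => simp [HasMor]
  | single i p h => exact ⟨𝟙 _, by simp, by simp⟩
  | splice i p h ξ ih => exact ⟨𝟙 _, 𝟙 _, by simp, by simp, ih⟩

lemma HasMor.comp {X X' X'' : C} {α : X ⟶ X'} {α' : X' ⟶ X''} {n : ℕ} {Y : C}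
    (ξ : 𝓔.YonedaExtension X n Y) : ∀ {Y' Y'' : C} {β : Y ⟶ Y'} {β' : Y' ⟶ Y''}
    (ξ' : 𝓔.YonedaExtension X' n Y') (ξ'' : 𝓔.YonedaExtension X'' n Y''),
    HasMor α ξ ξ' β → HasMor α' ξ' ξ'' β' → HasMor (α ≫ α') ξ ξ'' (β ≫ β') := by
  induction ξ with
  | hom f =>
    rintro _ _ _ _ (_ | _ | _) (_ | _ | _) h h'
    simp only [HasMor] at h h' ⊢
    rw [reassoc_of% h, h', Category.assoc]
  | single i p h =>
    rintro _ _ _ _ (_ | _ | _) (_ | _ | _) ⟨γ, h₁, h₂⟩ ⟨γ', h₁', h₂'⟩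
    exact ⟨γ ≫ γ', by rw [reassoc_of% h₁, h₁', Category.assoc],
      by rw [reassoc_of% h₂, h₂', Category.assoc]⟩
  | splice i p h ξ ih =>
    rintro _ _ _ _ (_ | _ | ⟨i', p', _, ξ'⟩) (_ | _ | ⟨i'', p'', _, ξ''⟩) ⟨ζ, γ, h₁, h₂, h₃⟩
      ⟨ζ', γ', h₁', h₂', h₃'⟩
    exact ⟨ζ ≫ ζ', γ ≫ γ', by rw [reassoc_of% h₁, h₁', Category.assoc],
      by rw [reassoc_of% h₂, h₂', Category.assoc], ih _ _ h₃ h₃'⟩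

/-- The push-out of an extension along a morphism out of its left end. -/
lemma exists_pushout {X X' : C} {n : ℕ} {Y : C} (ξ : 𝓔.YonedaExtension X n Y) (α : X ⟶ X') :
    ∃ η : 𝓔.YonedaExtension X' n Y, HasMor α ξ η (𝟙 Y) ∧
      ∀ {X'' Y'' : C} (α' : X' ⟶ X'') (β : Y ⟶ Y'') (ξ'' : 𝓔.YonedaExtension X'' n Y''),
        HasMor (α ≫ α') ξ ξ'' β → HasMor α' η ξ'' β := by
  induction ξ with
  | hom f =>
    refine ⟨.hom (f ≫ α), by simp [HasMor], ?_⟩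
    rintro _ _ _ _ (_ | _ | _) h
    simpa [HasMor] using h
  | single i p h =>
    obtain ⟨B, f', i', p', sq, hc, hp⟩ := h.exists_pushout α
    refine ⟨.single i' p' hc, ⟨f', sq.w, by simp [hp]⟩, ?_⟩
    rintro _ _ α' β (_ | ⟨i'', p'', h''⟩ | _) ⟨γ, h₁, h₂⟩
    refine ⟨sq.desc γ (α' ≫ i'') (by simpa using h₁), by simp, sq.hom_ext ?_ ?_⟩
    · simp [reassoc_of% hp, h₂]
    · simp [reassoc_of% hc.zero, h''.zero]
  | splice i p h ξ ih =>
    obtain ⟨η, hη, hη'⟩ := ih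
    refine ⟨.splice i p h η, ⟨𝟙 _, 𝟙 _, by simp, by simp, hη⟩, ?_⟩
    rintro _ _ α' β (_ | _ | ⟨i'', p'', h'', ξ''⟩) ⟨ζ, γ, h₁, h₂, h₃⟩
    exact ⟨ζ, γ, h₁, h₂, hη' _ _ _ h₃⟩

/-- The pull-back of an extension along a morphism into its right end. -/
lemma exists_pullback {X : C} {n : ℕ} {Y Y' : C} (ξ : 𝓔.YonedaExtension X n Y) (β : Y' ⟶ Y) :
    ∃ η : 𝓔.YonedaExtension X n Y', HasMor (𝟙 X) η ξ β ∧
      ∀ {X'' Y'' : C} (α : X'' ⟶ X) (β' : Y'' ⟶ Y') (ξ'' : 𝓔.YonedaExtension X'' n Y''),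
        HasMor α ξ'' ξ (β' ≫ β) → HasMor α ξ'' η β' := by
  cases ξ with
  | hom f =>
    refine ⟨.hom (β ≫ f), by simp [HasMor], ?_⟩
    rintro _ _ _ _ (_ | _ | _) h
    simpa [HasMor] using h
  | single i p h =>
    obtain ⟨B, f', i', p', sq, hc, hp⟩ := h.exists_pullback β
    refine ⟨.single i' p' hc, ⟨f', by simp [hp], sq.w.symm⟩, ?_⟩
    rintro _ _ α β' (_ | ⟨i'', p'', h''⟩ | _) ⟨γ, h₁, h₂⟩
    refine ⟨sq.lift γ (p'' ≫ β') (by simpa using h₂.symm), sq.hom_ext ?_ ?_, by simp⟩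
    · simp [hp, h₁]
    · simp [hc.zero, reassoc_of% h''.zero]
  | splice i p h ξ =>
    obtain ⟨B, f', i', p', sq, hc, hp⟩ := h.exists_pullback β
    refine ⟨.splice i' p' hc ξ, ⟨𝟙 _, f', by simp [hp], sq.w.symm, HasMor.id ξ⟩, ?_⟩
    rintro _ _ α β' (_ | _ | ⟨i'', p'', h'', ξ''⟩) ⟨ζ, γ, h₁, h₂, h₃⟩
    refine ⟨ζ, sq.lift γ (p'' ≫ β') (by simpa using h₂.symm), sq.hom_ext ?_ ?_, by simp, h₃⟩
    · simp [hp, h₁]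
    · simp [hc.zero, reassoc_of% h''.zero]

section

variable [HasBinaryBiproducts C]

/-- The direct sum of two extensions. -/
noncomputable def sum {X X' : C} : {n : ℕ} → {Y Y' : C} → 𝓔.YonedaExtension X n Y →
    𝓔.YonedaExtension X' n Y' → 𝓔.YonedaExtension (X ⊞ X') n (Y ⊞ Y')
  | _, _, _, .hom f, .hom f' => .hom (biprod.map f f')
  | _, _, _, .single i p h, .single i' p' h' =>
      .single (biprod.map i i') (biprod.map p p') (h.biprod_map h')
  | _, _, _, .splice i p h ξ, .splice i' p' h' ξ' =>
      .splice (biprod.map i i') (biprod.map p p') (h.biprod_map h') (sum ξ ξ')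

lemma HasMor.sum_map {X X' X₁ X₁' : C} {α : X ⟶ X₁} {α' : X' ⟶ X₁'} {n : ℕ} {Y : C}
    (ξ : 𝓔.YonedaExtension X n Y) : ∀ {Y' Y₁ Y₁' : C} {β : Y ⟶ Y₁} {β' : Y' ⟶ Y₁'}
    (ξ' : 𝓔.YonedaExtension X' n Y') (ξ₁ : 𝓔.YonedaExtension X₁ n Y₁)
    (ξ₁' : 𝓔.YonedaExtension X₁' n Y₁'), HasMor α ξ ξ₁ β → HasMor α' ξ' ξ₁' β' →
      HasMor (biprod.map α α') (sum ξ ξ') (sum ξ₁ ξ₁') (biprod.map β β') := by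
  induction ξ with
  | hom f =>
    rintro _ _ _ _ _ (_ | _ | _) (_ | _ | _) (_ | _ | _) h h'
    simp only [HasMor, sum] at h h' ⊢
    ext <;> simp [h, h']
  | single i p h =>
    rintro _ _ _ _ _ (_ | _ | _) (_ | _ | _) (_ | _ | _) ⟨γ, h₁, h₂⟩ ⟨γ', h₁', h₂'⟩
    exact ⟨biprod.map γ γ', by ext <;> simp [h₁, h₁'], by ext <;> simp [h₂, h₂']⟩
  | splice i p h ξ ih =>
    rintro _ _ _ _ _ (_ | _ | _) (_ | _ | _) (_ | _ | _) ⟨ζ, γ, h₁, h₂, h₃⟩ ⟨ζ', γ', h₁', h₂', h₃'⟩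
    exact ⟨biprod.map ζ ζ', biprod.map γ γ', by ext <;> simp [h₁, h₁'], by ext <;> simp [h₂, h₂'],
      ih _ _ _ h₃ h₃'⟩

lemma HasMor.diag {X : C} {n : ℕ} {Y : C} (ξ : 𝓔.YonedaExtension X n Y) :
    HasMor (biprod.lift (𝟙 X) (𝟙 X)) ξ (sum ξ ξ) (biprod.lift (𝟙 Y) (𝟙 Y)) := by
  induction ξ with
  | hom f => simp only [HasMor, sum]; ext <;> simp
  | single i p h => exact ⟨biprod.lift (𝟙 _) (𝟙 _), by ext <;> simp, by ext <;> simp⟩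
  | splice i p h ξ ih =>
    exact ⟨biprod.lift (𝟙 _) (𝟙 _), biprod.lift (𝟙 _) (𝟙 _), by ext <;> simp, by ext <;> simp, ih⟩

lemma HasMor.swap {X X' : C} {n : ℕ} {Y : C} (ξ : 𝓔.YonedaExtension X n Y) :
    ∀ {Y' : C} (ξ' : 𝓔.YonedaExtension X' n Y'), HasMor (biprod.braiding X X').hom (sum ξ ξ')
      (sum ξ' ξ) (biprod.braiding Y Y').hom := by
  induction ξ with
  | hom f =>
    rintro _ (_ | _ | _)
    simp only [HasMor, sum]; ext <;> simp
  | single i p h =>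
    rintro _ (_ | _ | _)
    exact ⟨(biprod.braiding _ _).hom, by ext <;> simp, by ext <;> simp⟩
  | splice i p h ξ ih =>
    rintro _ (_ | _ | _)
    exact ⟨(biprod.braiding _ _).hom, (biprod.braiding _ _).hom, by ext <;> simp, by ext <;> simp,
      ih _⟩

lemma HasMor.assoc {X X' X'' : C} {n : ℕ} {Y : C} (ξ : 𝓔.YonedaExtension X n Y) :
    ∀ {Y' Y'' : C} (ξ' : 𝓔.YonedaExtension X' n Y') (ξ'' : 𝓔.YonedaExtension X'' n Y''),
      HasMor (biprod.associator X X' X'').hom (sum (sum ξ ξ') ξ'') (sum ξ (sum ξ' ξ''))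
        (biprod.associator Y Y' Y'').hom := by
  induction ξ with
  | hom f =>
    rintro _ _ (_ | _ | _) (_ | _ | _)
    simp only [HasMor, sum]; ext <;> simp
  | single i p h =>
    rintro _ _ (_ | _ | _) (_ | _ | _)
    exact ⟨(biprod.associator _ _ _).hom, by ext <;> simp, by ext <;> simp⟩
  | splice i p h ξ ih =>
    rintro _ _ (_ | _ | _) (_ | _ | _)
    exact ⟨(biprod.associator _ _ _).hom, (biprod.associator _ _ _).hom, by ext <;> simp,
      by ext <;> simp, ih _ _⟩

open scoped ZeroObject in
variable (𝓔) in
/-- The trivial `n`-fold extension: the zero morphism for `n = 0`, the split conflation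
`X ⟶ X ⊞ Y ⟶ Y` for `n = 1`, and `0 ⟶ X ⟶ X ⊞ 0 ⟶ 0 ⟶ ⋯ ⟶ 0 ⟶ Y ⟶ Y ⟶ 0` for `n ≥ 2`. -/
noncomputable def trivial [HasZeroObject C] (X : C) : (n : ℕ) → (Y : C) → 𝓔.YonedaExtension X n Y
  | 0, _ => .hom 0
  | 1, Y => .single biprod.inl biprod.snd (𝓔.isConflation_split X Y)
  | n + 2, Y => .splice 0 (𝟙 Y) (𝓔.isConflation_zero_id (isZero_zero C) Y)
      (trivial X (n + 1) (0 : C))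

lemma HasMor.to_trivial [HasZeroObject C] {X X' : C} {n : ℕ} {Y Y' : C}
    (ξ : 𝓔.YonedaExtension X n Y) (β : Y ⟶ Y') : HasMor (0 : X ⟶ X') ξ (trivial 𝓔 X' n Y') β := by
  induction ξ generalizing Y' with
  | hom f => simp [HasMor, trivial]
  | single i p h => exact ⟨p ≫ β ≫ biprod.inr, by simp [reassoc_of% h.zero], by simp⟩
  | splice i p h ξ ih => exact ⟨0, p ≫ β, by simp [reassoc_of% h.zero], by simp, ih _⟩

end

end YonedaExtension

open YonedaExtension

variable (𝓔)

/-- The Yoneda extension group `Extⁿ(Y, X)` of an exact category: the classes of `n`-fold extensions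
of `Y` by `X` under the equivalence relation generated by the morphisms of extensions that are the
identity at both ends. In degree `0` this is the group of morphisms `Y ⟶ X`. -/
def Ext (n : ℕ) (Y X : C) : Type (max u v) :=
  Quot fun ξ η : 𝓔.YonedaExtension X n Y => HasMor (𝟙 X) ξ η (𝟙 Y)

variable {𝓔}

namespace Ext

variable {n : ℕ}

/-- The class of an `n`-fold extension. -/
def mk {Y X : C} (ξ : 𝓔.YonedaExtension X n Y) : 𝓔.Ext n Y X := Quot.mk _ ξ

lemma mk_eq {Y X : C} {ξ η : 𝓔.YonedaExtension X n Y} (h : HasMor (𝟙 X) ξ η (𝟙 Y)) :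
    mk ξ = mk η := Quot.sound h

lemma exists_mk {Y X : C} (x : 𝓔.Ext n Y X) : ∃ ξ : 𝓔.YonedaExtension X n Y, mk ξ = x :=
  Quot.exists_rep x

/-- Covariant functoriality of `Extⁿ(Y, X)` in `X`, by push-out. -/
noncomputable def push {X X' : C} (α : X ⟶ X') {Y : C} : 𝓔.Ext n Y X → 𝓔.Ext n Y X' :=
  Quot.lift (fun ξ => mk (ξ.exists_pushout α).choose) fun ξ η h => mk_eq <| by
    have hη := (η.exists_pushout α).choose_spec.1
    refine (ξ.exists_pushout α).choose_spec.2 (𝟙 X') (𝟙 Y) _ ?_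
    simpa using HasMor.comp _ _ _ h hη

/-- Contravariant functoriality of `Extⁿ(Y, X)` in `Y`, by pull-back. -/
noncomputable def pull {Y Y' : C} (β : Y' ⟶ Y) {X : C} : 𝓔.Ext n Y X → 𝓔.Ext n Y' X :=
  Quot.lift (fun ξ => mk (ξ.exists_pullback β).choose) fun ξ η h => mk_eq <| by
    have hξ := (ξ.exists_pullback β).choose_spec.1
    refine (η.exists_pullback β).choose_spec.2 (𝟙 X) (𝟙 Y') _ ?_
    simpa using HasMor.comp _ _ _ hξ h

lemma push_mk_eq_pull_mk {X X' Y Y' : C} {α : X ⟶ X'} {β : Y ⟶ Y'} {ξ : 𝓔.YonedaExtension X n Y}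
    {η : 𝓔.YonedaExtension X' n Y'} (h : HasMor α ξ η β) : push α (mk ξ) = pull β (mk η) := by
  refine mk_eq ?_
  refine (η.exists_pullback β).choose_spec.2 _ _ _ ?_
  refine (ξ.exists_pushout α).choose_spec.2 _ _ _ ?_
  simpa using h

lemma exists_push_mk {X X' Y : C} (α : X ⟶ X') (ξ : 𝓔.YonedaExtension X n Y) :
    ∃ η : 𝓔.YonedaExtension X' n Y, push α (mk ξ) = mk η ∧ HasMor α ξ η (𝟙 Y) :=
  ⟨_, rfl, (ξ.exists_pushout α).choose_spec.1⟩

lemma exists_pull_mk {X Y Y' : C} (β : Y' ⟶ Y) (ξ : 𝓔.YonedaExtension X n Y) :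
    ∃ η : 𝓔.YonedaExtension X n Y', pull β (mk ξ) = mk η ∧ HasMor (𝟙 X) η ξ β :=
  ⟨_, rfl, (ξ.exists_pullback β).choose_spec.1⟩

@[simp]
lemma push_id {X Y : C} (x : 𝓔.Ext n Y X) : push (𝟙 X) x = x := by
  obtain ⟨ξ, rfl⟩ := exists_mk x
  obtain ⟨η, hη, h⟩ := exists_push_mk (𝟙 X) ξ
  rw [hη, mk_eq h]

@[simp]
lemma pull_id {X Y : C} (x : 𝓔.Ext n Y X) : pull (𝟙 Y) x = x := by
  obtain ⟨ξ, rfl⟩ := exists_mk x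
  obtain ⟨η, hη, h⟩ := exists_pull_mk (𝟙 Y) ξ
  rw [hη, mk_eq h]

lemma push_mk_eq {X X' Y : C} {α : X ⟶ X'} {ξ : 𝓔.YonedaExtension X n Y}
    {η : 𝓔.YonedaExtension X' n Y} (h : HasMor α ξ η (𝟙 Y)) : push α (mk ξ) = mk η := by
  rw [push_mk_eq_pull_mk h, pull_id]

lemma pull_mk_eq {X Y Y' : C} {β : Y ⟶ Y'} {ξ : 𝓔.YonedaExtension X n Y}
    {η : 𝓔.YonedaExtension X n Y'} (h : HasMor (𝟙 X) ξ η β) : pull β (mk η) = mk ξ := by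
  rw [← push_mk_eq_pull_mk h, push_id]

lemma push_push {X X' X'' Y : C} (α : X ⟶ X') (α' : X' ⟶ X'') (x : 𝓔.Ext n Y X) :
    push α' (push α x) = push (α ≫ α') x := by
  obtain ⟨ξ, rfl⟩ := exists_mk x
  obtain ⟨η, hη, h⟩ := exists_push_mk α ξ
  obtain ⟨η', hη', h'⟩ := exists_push_mk α' η
  rw [hη, hη', push_mk_eq]
  simpa using HasMor.comp _ _ _ h h'

lemma pull_pull {X Y Y' Y'' : C} (β : Y ⟶ Y') (β' : Y' ⟶ Y'') (x : 𝓔.Ext n Y'' X) :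
    pull β (pull β' x) = pull (β ≫ β') x := by
  obtain ⟨ξ, rfl⟩ := exists_mk x
  obtain ⟨η, hη, h⟩ := exists_pull_mk β' ξ
  obtain ⟨η', hη', h'⟩ := exists_pull_mk β η
  rw [hη, hη', pull_mk_eq]
  simpa using HasMor.comp _ _ _ h' h

lemma push_pull {X X' Y Y' : C} (α : X ⟶ X') (β : Y ⟶ Y') (x : 𝓔.Ext n Y' X) :
    push α (pull β x) = pull β (push α x) := by
  obtain ⟨ξ, rfl⟩ := exists_mk x
  obtain ⟨η, hη, h⟩ := exists_pull_mk β ξ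
  obtain ⟨η', hη', h'⟩ := exists_push_mk α ξ
  rw [hη, hη', push_mk_eq_pull_mk]
  simpa using HasMor.comp _ _ _ h h'

section Group

variable [HasBinaryBiproducts C]

lemma biprod_map_id_id (X Y : C) : biprod.map (𝟙 X) (𝟙 Y) = 𝟙 (X ⊞ Y) := by
  ext <;> simp

/-- The direct sum of two extension classes. -/
noncomputable def sum {X X' Y Y' : C} : 𝓔.Ext n Y X → 𝓔.Ext n Y' X' →
    𝓔.Ext n (Y ⊞ Y') (X ⊞ X') :=
  Quot.map₂ YonedaExtension.sum
    (fun ξ η η' h => by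
      simpa only [biprod_map_id_id] using HasMor.sum_map _ _ _ _ (HasMor.id ξ) h)
    (fun ξ ξ' η h => by
      simpa only [biprod_map_id_id] using HasMor.sum_map _ _ _ _ h (HasMor.id η))

lemma sum_mk {X X' Y Y' : C} (ξ : 𝓔.YonedaExtension X n Y) (η : 𝓔.YonedaExtension X' n Y') :
    sum (mk ξ) (mk η) = mk (ξ.sum η) := rfl

lemma push_sum {X X' X₁ X₁' Y Y' : C} (α : X ⟶ X₁) (α' : X' ⟶ X₁') (x : 𝓔.Ext n Y X)
    (y : 𝓔.Ext n Y' X') : sum (push α x) (push α' y) = push (biprod.map α α') (sum x y) := by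
  obtain ⟨ξ, rfl⟩ := exists_mk x
  obtain ⟨η, rfl⟩ := exists_mk y
  obtain ⟨ξ', hξ, h⟩ := exists_push_mk α ξ
  obtain ⟨η', hη, h'⟩ := exists_push_mk α' η
  rw [hξ, hη, sum_mk, sum_mk, push_mk_eq]
  simpa only [biprod_map_id_id] using HasMor.sum_map _ _ _ _ h h'

lemma pull_sum {X X' Y Y' Y₁ Y₁' : C} (β : Y₁ ⟶ Y) (β' : Y₁' ⟶ Y') (x : 𝓔.Ext n Y X)
    (y : 𝓔.Ext n Y' X') : sum (pull β x) (pull β' y) = pull (biprod.map β β') (sum x y) := by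
  obtain ⟨ξ, rfl⟩ := exists_mk x
  obtain ⟨η, rfl⟩ := exists_mk y
  obtain ⟨ξ', hξ, h⟩ := exists_pull_mk β ξ
  obtain ⟨η', hη, h'⟩ := exists_pull_mk β' η
  rw [hξ, hη, sum_mk, sum_mk, pull_mk_eq]
  simpa only [biprod_map_id_id] using HasMor.sum_map _ _ _ _ h h'

/-- The Baer sum `∇ (x ⊕ y) Δ`. -/
noncomputable instance {Y X : C} : Add (𝓔.Ext n Y X) where
  add x y := push (biprod.desc (𝟙 X) (𝟙 X)) (pull (biprod.lift (𝟙 Y) (𝟙 Y)) (sum x y))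

lemma add_def {Y X : C} (x y : 𝓔.Ext n Y X) :
    x + y = push (biprod.desc (𝟙 X) (𝟙 X)) (pull (biprod.lift (𝟙 Y) (𝟙 Y)) (sum x y)) := rfl

lemma push_add {X X' Y : C} (α : X ⟶ X') (x y : 𝓔.Ext n Y X) :
    push α (x + y) = push α x + push α y := by
  rw [add_def, add_def, push_sum, ← push_pull, push_push, push_push]
  congr 1
  ext <;> simp

lemma pull_add {X Y Y' : C} (β : Y' ⟶ Y) (x y : 𝓔.Ext n Y X) :
    pull β (x + y) = pull β x + pull β y := by
  rw [add_def, add_def, pull_sum, ← push_pull, pull_pull, pull_pull]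
  congr 2
  ext <;> simp

lemma push_diag {X Y : C} (x : 𝓔.Ext n Y X) :
    push (biprod.lift (𝟙 X) (𝟙 X)) x = pull (biprod.lift (𝟙 Y) (𝟙 Y)) (sum x x) := by
  obtain ⟨ξ, rfl⟩ := exists_mk x
  exact push_mk_eq_pull_mk (HasMor.diag ξ)

lemma push_add_push {X X' Y : C} (α α' : X ⟶ X') (x : 𝓔.Ext n Y X) :
    push α x + push α' x = push (α + α') x := by
  rw [add_def, push_sum, ← push_pull, ← push_diag, push_push, push_push]
  have e : biprod.map α α' ≫ biprod.desc (𝟙 X') (𝟙 X') = biprod.desc α α' := by ext <;> simp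
  rw [e, biprod.add_eq_lift_id_desc]

lemma add_comm' {X Y : C} (x y : 𝓔.Ext n Y X) : x + y = y + x := by
  have key : push (biprod.braiding X X).hom (sum x y) =
      pull (biprod.braiding Y Y).hom (sum y x) := by
    obtain ⟨ξ, rfl⟩ := exists_mk x
    obtain ⟨η, rfl⟩ := exists_mk y
    exact push_mk_eq_pull_mk (HasMor.swap ξ η)
  have e₁ : (biprod.desc (𝟙 X) (𝟙 X) : X ⊞ X ⟶ X) =
    (biprod.braiding X X).hom ≫ biprod.desc (𝟙 X) (𝟙 X) := by ext <;> simp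
  have e₂ : (biprod.lift (𝟙 Y) (𝟙 Y) : Y ⟶ Y ⊞ Y) ≫ (biprod.braiding Y Y).hom =
    biprod.lift (𝟙 Y) (𝟙 Y) := by ext <;> simp
  rw [add_def, add_def, e₁, ← push_push, push_pull, key, pull_pull, e₂, ← e₁]

lemma add_assoc' {X Y : C} (x y z : 𝓔.Ext n Y X) : x + y + z = x + (y + z) := by
  have key : push (biprod.associator X X X).hom (sum (sum x y) z) =
      pull (biprod.associator Y Y Y).hom (sum x (sum y z)) := by
    obtain ⟨ξ, rfl⟩ := exists_mk x
    obtain ⟨η, rfl⟩ := exists_mk y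
    obtain ⟨θ, rfl⟩ := exists_mk z
    exact push_mk_eq_pull_mk (HasMor.assoc ξ η θ)
  have h₁ : x + y + z = push (biprod.desc (biprod.desc (𝟙 X) (𝟙 X)) (𝟙 X))
      (pull (biprod.lift (biprod.lift (𝟙 Y) (𝟙 Y)) (𝟙 Y)) (sum (sum x y) z)) := by
    rw [add_def, add_def]
    have aux : ∀ s : 𝓔.Ext n (Y ⊞ Y) (X ⊞ X),
        sum (push (biprod.desc (𝟙 X) (𝟙 X)) (pull (biprod.lift (𝟙 Y) (𝟙 Y)) s)) z =
          push (biprod.map (biprod.desc (𝟙 X) (𝟙 X)) (𝟙 X))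
            (pull (biprod.map (biprod.lift (𝟙 Y) (𝟙 Y)) (𝟙 Y)) (sum s z)) := fun s => by
      rw [← pull_sum, ← push_sum, push_id, pull_id]
    rw [aux, ← push_pull, pull_pull, push_push]
    congr 2 <;> ext <;> simp
  have h₂ : x + (y + z) = push (biprod.desc (𝟙 X) (biprod.desc (𝟙 X) (𝟙 X)))
      (pull (biprod.lift (𝟙 Y) (biprod.lift (𝟙 Y) (𝟙 Y))) (sum x (sum y z))) := by
    rw [add_def, add_def]
    have aux : ∀ s : 𝓔.Ext n (Y ⊞ Y) (X ⊞ X),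
        sum x (push (biprod.desc (𝟙 X) (𝟙 X)) (pull (biprod.lift (𝟙 Y) (𝟙 Y)) s)) =
          push (biprod.map (𝟙 X) (biprod.desc (𝟙 X) (𝟙 X)))
            (pull (biprod.map (𝟙 Y) (biprod.lift (𝟙 Y) (𝟙 Y))) (sum x s)) := fun s => by
      rw [← pull_sum, ← push_sum, push_id, pull_id]
    rw [aux, ← push_pull, pull_pull, push_push]
    congr 2 <;> ext <;> simp
  have e₁ : (biprod.desc (biprod.desc (𝟙 X) (𝟙 X)) (𝟙 X)) =
    (biprod.associator X X X).hom ≫ biprod.desc (𝟙 X) (biprod.desc (𝟙 X) (𝟙 X)) := by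
      ext <;> simp
  have e₂ : biprod.lift (biprod.lift (𝟙 Y) (𝟙 Y)) (𝟙 Y) ≫ (biprod.associator Y Y Y).hom =
    biprod.lift (𝟙 Y) (biprod.lift (𝟙 Y) (𝟙 Y)) := by ext <;> simp
  rw [h₁, h₂, e₁, ← push_push, push_pull, key, pull_pull, e₂]

variable [HasZeroObject C]

noncomputable instance {Y X : C} : Zero (𝓔.Ext n Y X) where
  zero := mk (YonedaExtension.trivial 𝓔 X n Y)

noncomputable instance {Y X : C} : Neg (𝓔.Ext n Y X) where
  neg x := push (-𝟙 X) x

lemma push_zero_mor {X X' Y : C} (x : 𝓔.Ext n Y X) : push (0 : X ⟶ X') x = 0 := by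
  obtain ⟨ξ, rfl⟩ := exists_mk x
  exact push_mk_eq (HasMor.to_trivial ξ _)

lemma add_zero' {X Y : C} (x : 𝓔.Ext n Y X) : x + 0 = x := by
  rw [← push_zero_mor (X' := X) x]
  nth_rw 1 [← push_id x]
  rw [push_add_push, add_zero, push_id]

/-- The Yoneda extension groups are abelian groups under Baer sum. -/
noncomputable instance {Y X : C} : AddCommGroup (𝓔.Ext n Y X) where
  add_assoc := add_assoc'
  add_comm := add_comm'
  add_zero := add_zero'
  zero_add x := by rw [add_comm', add_zero']
  neg_add_cancel x := by
    change push (-𝟙 X) x + x = 0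
    nth_rw 2 [← push_id x]
    rw [push_add_push, neg_add_cancel, push_zero_mor]
  nsmul := nsmulRec
  zsmul := zsmulRec

end Group

end Ext

end ExactStructure
end Exact

section Induced

open Opposite

variable {C : Type u} [Category.{v} C] [Preadditive C] {𝓔 : ExactStructure C}
variable {A : Type u'} [Category.{v'} A] [Abelian A]

namespace ExactStructure.YonedaExtension

/-- The image of an extension under a covariant functor to an abelian category is an exact
sequence, that is, all the conflations it is spliced from become short exact. -/
def MapExact (F : C ⥤ A) [F.Additive] {X : C} :
    {n : ℕ} → {Y : C} → 𝓔.YonedaExtension X n Y → Prop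
  | _, _, .hom _ => True
  | _, _, .single i p h => ((ShortComplex.mk i p h.zero).map F).ShortExact
  | _, _, .splice i p h ξ => ((ShortComplex.mk i p h.zero).map F).ShortExact ∧ MapExact F ξ

/-- The class in `Extⁿ(F Y, F X)` of the image under a covariant functor `F` of an `n`-fold
extension of `Y` by `X` that remains exact: the Yoneda product of the classes of the short exact
sequences it is spliced from. -/
noncomputable def mapClass [HasExt.{w} A] (F : C ⥤ A) [F.Additive] {X : C} :
    {n : ℕ} → {Y : C} → (ξ : 𝓔.YonedaExtension X n Y) → ξ.MapExact F →
      Abelian.Ext.{w} (F.obj Y) (F.obj X) n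
  | _, _, .hom f, _ => .mk₀ (F.map f)
  | _, _, .single _ _ _, hξ => ShortComplex.ShortExact.extClass hξ
  | n + 2, _, .splice _ _ _ ξ, hξ =>
      (ShortComplex.ShortExact.extClass hξ.1).comp (mapClass F ξ hξ.2) (add_comm 1 (n + 1))

/-- The short complex `G Z ⟶ G B ⟶ G A` obtained by applying a contravariant functor to a conflation
`A ⟶ B ⟶ Z`. -/
abbrev opMapShortComplex (G : Cᵒᵖ ⥤ A) [G.Additive] {X B Z : C} {i : X ⟶ B} {p : B ⟶ Z}
    (h : 𝓔.IsConflation i p) : ShortComplex A :=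
  (ShortComplex.mk i p h.zero).op.map G

/-- The image of an extension under a contravariant functor to an abelian category is an exact
sequence, that is, all the conflations it is spliced from become short exact. -/
def OpMapExact (G : Cᵒᵖ ⥤ A) [G.Additive] {X : C} :
    {n : ℕ} → {Y : C} → 𝓔.YonedaExtension X n Y → Prop
  | _, _, .hom _ => True
  | _, _, .single _ _ h => (opMapShortComplex G h).ShortExact
  | _, _, .splice _ _ h ξ => (opMapShortComplex G h).ShortExact ∧ OpMapExact G ξ

/-- The class in `Extⁿ(G X, G Y)` of the image under a contravariant functor `G` of an `n`-fold
extension of `Y` by `X` that remains exact: the Yoneda product of the classes of the short exact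
sequences it is spliced from. -/
noncomputable def opMapClass [HasExt.{w} A] (G : Cᵒᵖ ⥤ A) [G.Additive] {X : C} :
    {n : ℕ} → {Y : C} → (ξ : 𝓔.YonedaExtension X n Y) → ξ.OpMapExact G →
      Abelian.Ext.{w} (G.obj (op X)) (G.obj (op Y)) n
  | _, _, .hom f, _ => .mk₀ (G.map f.op)
  | _, _, .single _ _ _, hξ => ShortComplex.ShortExact.extClass hξ
  | _, _, .splice _ _ _ ξ, hξ =>
      (opMapClass G ξ hξ.2).comp (ShortComplex.ShortExact.extClass hξ.1) rfl

end ExactStructure.YonedaExtension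

end Induced

section Subcategory

variable {C : Type u} [Category.{v} C] [Preadditive C]

/-- The contravariant functor `Ψ : X ↦ Hom(X, -)|_M` from `C` to the category `M-Mod` of left
`M`-modules (covariant additive functors from `M` to abelian groups). -/
def psi (M : ObjectProperty C) : Cᵒᵖ ⥤ (M.FullSubcategory ⥤+ AddCommGrpCat.{v}) where
  obj X := AdditiveFunctor.of (M.ι ⋙ preadditiveCoyoneda.obj X)
  map f := ⟨M.ι.whiskerLeft (preadditiveCoyoneda.map f)⟩

/-- The functor `Φ : X ↦ Hom(-, X)|_M` from `C` to the category `Mod-M` of right `M`-modules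
(contravariant additive functors from `M` to abelian groups). -/
def phi (M : ObjectProperty C) : C ⥤ (M.FullSubcategoryᵒᵖ ⥤+ AddCommGrpCat.{v}) where
  obj X := AdditiveFunctor.of (M.ι.op ⋙ preadditiveYoneda.obj X)
  map f := ⟨M.ι.op.whiskerLeft (preadditiveYoneda.map f)⟩

instance (M : ObjectProperty C) : (psi M).Additive where
  map_add {X Y f g} := by
    ext N x
    exact Preadditive.add_comp _ _ _ _ _ _

instance (M : ObjectProperty C) : (phi M).Additive where
  map_add {X Y f g} := by
    ext N x
    exact Preadditive.comp_add _ _ _ _ _ _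

namespace ExactStructure

variable (𝓔 : ExactStructure C)

/-- The objects `X` of `cogenᵏ(M)`: there is an exact sequence
`0 ⟶ X ⟶ M₀ ⟶ ⋯ ⟶ Mₖ ⟶ Z ⟶ 0` with all `Mⱼ` in `M`, spliced from conflations
`Zⱼ ⟶ Mⱼ ⟶ Zⱼ₊₁` for `0 ≤ j ≤ k` with `Z₀ = X` and `Zₖ₊₁ = Z`, such that
`Hom(Mₖ, N) ⟶ ⋯ ⟶ Hom(M₀, N) ⟶ Hom(X, N) ⟶ 0` is exact for all `N` in `M`.
The values of the sequences at indices beyond those above are irrelevant. -/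
def cogen (M : ObjectProperty C) (k : ℕ) : ObjectProperty C := fun X =>
  ∃ (Z M' : ℕ → C) (ι : ∀ j, Z j ⟶ M' j) (π : ∀ j, M' j ⟶ Z (j + 1)),
    Z 0 = X ∧ (∀ j ≤ k, M (M' j) ∧ 𝓔.IsConflation (ι j) (π j)) ∧
    ∀ N : C, M N →
      Function.Surjective (fun g : M' 0 ⟶ N => ι 0 ≫ g) ∧
      (0 < k → Function.Exact (fun g : M' 1 ⟶ N => (π 0 ≫ ι 1) ≫ g)
        (fun g : M' 0 ⟶ N => ι 0 ≫ g)) ∧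
      ∀ j, j + 1 < k → Function.Exact (fun g : M' (j + 2) ⟶ N => (π (j + 1) ≫ ι (j + 2)) ≫ g)
        (fun g : M' (j + 1) ⟶ N => (π j ≫ ι (j + 1)) ≫ g)

/-- The objects `X` of `genₖ(M)`: there is an exact sequence
`0 ⟶ Z ⟶ Mₖ ⟶ ⋯ ⟶ M₀ ⟶ X ⟶ 0` with all `Mⱼ` in `M`, spliced from conflations
`Zⱼ₊₁ ⟶ Mⱼ ⟶ Zⱼ` for `0 ≤ j ≤ k` with `Z₀ = X` and `Zₖ₊₁ = Z`, such that
`Hom(N, Mₖ) ⟶ ⋯ ⟶ Hom(N, M₀) ⟶ Hom(N, X) ⟶ 0` is exact for all `N` in `M`.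
The values of the sequences at indices beyond those above are irrelevant. -/
def gen (M : ObjectProperty C) (k : ℕ) : ObjectProperty C := fun X =>
  ∃ (Z M' : ℕ → C) (ι : ∀ j, Z (j + 1) ⟶ M' j) (π : ∀ j, M' j ⟶ Z j),
    Z 0 = X ∧ (∀ j ≤ k, M (M' j) ∧ 𝓔.IsConflation (ι j) (π j)) ∧
    ∀ N : C, M N →
      Function.Surjective (fun g : N ⟶ M' 0 => g ≫ π 0) ∧
      (0 < k → Function.Exact (fun g : N ⟶ M' 1 => g ≫ π 1 ≫ ι 0)
        (fun g : N ⟶ M' 0 => g ≫ π 0)) ∧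
      ∀ j, j + 1 < k → Function.Exact (fun g : N ⟶ M' (j + 2) => g ≫ π (j + 2) ≫ ι (j + 1))
        (fun g : N ⟶ M' (j + 1) => g ≫ π (j + 1) ≫ ι j)

variable [HasZeroObject C] [HasBinaryBiproducts C]

/-- The objects `Y` with `Extⁱ(Y, N) = 0` for all `N` in `M` and `1 ≤ i < k`. -/
def leftExtOrthogonal (M : ObjectProperty C) (k : ℕ) : ObjectProperty C := fun Y =>
  ∀ i, 1 ≤ i → i < k → ∀ N : C, M N → ∀ x : 𝓔.Ext i Y N, x = 0

/-- The objects `X` with `Extⁱ(N, X) = 0` for all `N` in `M` and `1 ≤ i < k`. -/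
def rightExtOrthogonal (M : ObjectProperty C) (k : ℕ) : ObjectProperty C := fun X =>
  ∀ i, 1 ≤ i → i < k → ∀ N : C, M N → ∀ x : 𝓔.Ext i N X, x = 0

end ExactStructure

end Subcategory

/-!
Both halves are the same statement: taking opposites carries `Ext` of `𝓔` to `Ext` of `𝓔.op`,
`cogen` to `gen` and `Ψ` to the contravariant `Φ`, so it suffices to treat `Φ`. By the Yoneda
lemma `Φ` is bijective on `Hom(N, -)` for `N` in `M` and sends `N` to a projective, and it sends a
conflation `Z ⟶ M₀ ⟶ Y` along which morphisms from `M` lift to a short exact sequence. For `M₀`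
in `M`, the connecting maps of this conflation and of its image present `Extⁱ⁺¹(Y, X)` and
`Extⁱ⁺¹(Φ Y, Φ X)` as cokernels of `Extⁱ(M₀, X) ⟶ Extⁱ(Z, X)` and of its analogue over `M`,
since `Extⁱ⁺¹(M₀, X)` vanishes and `Φ M₀` is projective. Induction along the resolution of `Y`
compares them, starting in degree `0` with the full faithfulness of `Φ` on objects presented
by `M`.
-/

section
variable {C : Type u} [Category.{v} C] [Preadditive C] {𝓔 : ExactStructure C}

namespace ExactStructure

namespace IsConflation

variable {A B Z : C} {i : A ⟶ B} {p : B ⟶ Z}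

lemma deflation (h : 𝓔.IsConflation i p) : IsDeflationFor 𝓔.conflation p :=
  ⟨_, i, h.1, h.2⟩

lemma exists_comp (h : 𝓔.IsConflation i p) {A' Y : C} {i' : A' ⟶ Z} {p' : Z ⟶ Y}
    (h' : 𝓔.IsConflation i' p') : ∃ (K : C) (k : K ⟶ B), 𝓔.IsConflation k (p ≫ p') := by
  obtain ⟨K, k, w, hk⟩ := 𝓔.deflation_comp p p' h.deflation h'.deflation
  exact ⟨K, k, w, hk⟩

lemma exists_section (h : 𝓔.IsConflation i p) {r : B ⟶ A} (hr : i ≫ r = 𝟙 A) :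
    ∃ s : Z ⟶ B, s ≫ p = 𝟙 Z := by
  obtain ⟨s, hs⟩ := h.exists_desc (𝟙 B - r ≫ i) (by simp [reassoc_of% hr])
  have := h.epi
  exact ⟨s, by rw [← cancel_epi p, reassoc_of% hs]; simp [h.zero]⟩

lemma exists_retraction (h : 𝓔.IsConflation i p) {s : Z ⟶ B} (hs : s ≫ p = 𝟙 Z) :
    ∃ r : B ⟶ A, i ≫ r = 𝟙 A := by
  obtain ⟨r, hr⟩ := h.exists_lift (𝟙 B - p ≫ s) (by simp [hs])
  have := h.mono
  exact ⟨r, by rw [← cancel_mono i, Category.assoc, hr]; simp [reassoc_of% h.zero]⟩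

end IsConflation

namespace YonedaExtension

/-- The morphism underlying a `0`-fold extension. -/
def toHom {X Y : C} : 𝓔.YonedaExtension X 0 Y → (Y ⟶ X)
  | .hom f => f

/-- A `1`-fold extension is split if its inflation has a retraction. -/
def IsSplit {X Y : C} : 𝓔.YonedaExtension X 1 Y → Prop
  | .single (E := E) i _ _ => ∃ r : E ⟶ X, i ≫ r = 𝟙 X

lemma HasMor.toHom_eq {X Y : C} : ∀ {ξ η : 𝓔.YonedaExtension X 0 Y},
    HasMor (𝟙 X) ξ η (𝟙 Y) → ξ.toHom = η.toHom
  | .hom _, .hom _, h => by simpa [HasMor, toHom] using h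

lemma HasMor.isSplit_iff {X Y : C} {ξ η : 𝓔.YonedaExtension X 1 Y}
    (H : HasMor (𝟙 X) ξ η (𝟙 Y)) : ξ.IsSplit ↔ η.IsSplit := by
  obtain _ | ⟨i, p, h⟩ | _ := ξ
  obtain _ | ⟨i', p', h'⟩ | _ := η
  obtain ⟨γ, h₁, h₂⟩ := H
  constructor
  · rintro ⟨r, hr⟩
    obtain ⟨s, hs⟩ := h.exists_section hr
    exact h'.exists_retraction (s := s ≫ γ) (by rw [Category.assoc, ← h₂, reassoc_of% hs])
  · rintro ⟨r, hr⟩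
    exact ⟨γ ≫ r, by rw [reassoc_of% h₁, hr]⟩

lemma HasMor.codiag [HasBinaryBiproducts C] {X : C} {n : ℕ} {Y : C}
    (ξ : 𝓔.YonedaExtension X n Y) :
    HasMor (biprod.desc (𝟙 X) (𝟙 X)) (sum ξ ξ) ξ (biprod.desc (𝟙 Y) (𝟙 Y)) := by
  induction ξ with
  | hom f => simp only [HasMor, sum]; ext <;> simp
  | single i p _ => exact ⟨biprod.desc (𝟙 _) (𝟙 _), by ext <;> simp, by ext <;> simp⟩
  | splice i p _ ξ ih =>
    exact ⟨biprod.desc (𝟙 _) (𝟙 _), biprod.desc (𝟙 _) (𝟙 _), by ext <;> simp, by ext <;> simp, ih⟩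

lemma HasMor.from_trivial [HasBinaryBiproducts C] [HasZeroObject C] {X : C} {n : ℕ} {Y Y' : C}
    (ξ : 𝓔.YonedaExtension X n Y) :
    HasMor (𝟙 X) (trivial 𝓔 X n Y') ξ (0 : Y' ⟶ Y) := by
  induction ξ generalizing Y' with
  | hom f => simp [HasMor, trivial]
  | single i p h => exact ⟨biprod.desc i 0, by simp, by ext <;> simp [h.zero]⟩
  | splice i p _ ξ ih => exact ⟨0, 0, by simp, by simp, ih⟩

end YonedaExtension

open YonedaExtension

namespace Ext

variable {n : ℕ}

lemma isSplit_iff_of_mk_eq {X Y : C} {ξ η : 𝓔.YonedaExtension X 1 Y} (h : mk ξ = mk η) :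
    ξ.IsSplit ↔ η.IsSplit :=
  iff_of_eq (congrArg (Quot.lift IsSplit fun _ _ H => propext H.isSplit_iff) h)

lemma mk_hom_injective (Y X : C) :
    Function.Injective fun f : Y ⟶ X => (mk (.hom f) : 𝓔.Ext 0 Y X) :=
  fun _ _ h => congrArg (Quot.lift toHom fun _ _ H => H.toHom_eq) h

lemma mk_hom_surjective (Y X : C) :
    Function.Surjective fun f : Y ⟶ X => (mk (.hom f) : 𝓔.Ext 0 Y X) := by
  intro x
  obtain ⟨_ | _ | _, rfl⟩ := exists_mk x
  exact ⟨_, rfl⟩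

lemma push_mk_hom {X X' Y : C} (α : X ⟶ X') (f : Y ⟶ X) :
    push α (mk (.hom f) : 𝓔.Ext 0 Y X) = mk (.hom (f ≫ α)) :=
  push_mk_eq (by simp [HasMor])

lemma pull_mk_hom {X Y Y' : C} (β : Y' ⟶ Y) (f : Y ⟶ X) :
    pull β (mk (.hom f) : 𝓔.Ext 0 Y X) = mk (.hom (β ≫ f)) :=
  pull_mk_eq (by simp [HasMor])

variable [HasBinaryBiproducts C]

lemma pull_add_pull {X Y Y' : C} (β β' : Y' ⟶ Y) (x : 𝓔.Ext n Y X) :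
    pull β x + pull β' x = pull (β + β') x := by
  have h : push (biprod.desc (𝟙 X) (𝟙 X)) (sum x x) = pull (biprod.desc (𝟙 Y) (𝟙 Y)) x := by
    obtain ⟨ξ, rfl⟩ := exists_mk x
    exact push_mk_eq_pull_mk (HasMor.codiag ξ)
  rw [add_def, pull_sum, pull_pull, push_pull, h, pull_pull]
  congr 1
  have e : biprod.map β β' ≫ biprod.desc (𝟙 Y) (𝟙 Y) = biprod.desc β β' := by ext <;> simp
  rw [Category.assoc, e, biprod.add_eq_lift_id_desc]

lemma mk_hom_add {X Y : C} (f g : Y ⟶ X) :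
    (mk (.hom (f + g)) : 𝓔.Ext 0 Y X) = mk (.hom f) + mk (.hom g) := by
  have := push_add_push f g (mk (.hom (𝟙 Y)) : 𝓔.Ext 0 Y Y)
  simpa [push_mk_hom] using this.symm

/-- Extensions of degree zero are morphisms. -/
noncomputable def homAddEquiv (Y X : C) : (Y ⟶ X) ≃+ 𝓔.Ext 0 Y X :=
  AddEquiv.mk' (Equiv.ofBijective _ ⟨mk_hom_injective Y X, mk_hom_surjective Y X⟩) mk_hom_add

variable [HasZeroObject C]

lemma pull_zero_mor {X Y Y' : C} (x : 𝓔.Ext n Y X) : pull (0 : Y' ⟶ Y) x = 0 := by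
  obtain ⟨ξ, rfl⟩ := exists_mk x
  exact pull_mk_eq (HasMor.from_trivial ξ)

lemma pull_zero {X Y Y' : C} (β : Y' ⟶ Y) : pull β (0 : 𝓔.Ext n Y X) = 0 := by
  rw [← push_zero_mor (X' := X) (0 : 𝓔.Ext n Y X), ← push_pull, push_zero_mor]

/-- `x` and `y` are the images of a single class of `Extⁿ(Y, X ⊞ X)` under the two projections,
and `x + y` is its image under their sum. -/
lemma map_add_of_natural {G : C → Type*} [∀ X, Add (G X)]
    {a : ∀ {X X' : C}, (X ⟶ X') → G X → G X'}
    (ha : ∀ {X X' : C} (α α' : X ⟶ X') (z : G X), a α z + a α' z = a (α + α') z) {Y : C}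
    {T : ∀ X : C, 𝓔.Ext n Y X → G X}
    (hT : ∀ {X X' : C} (α : X ⟶ X') (x : 𝓔.Ext n Y X), T X' (push α x) = a α (T X x))
    {X : C} (x y : 𝓔.Ext n Y X) : T X (x + y) = T X x + T X y := by
  let z : 𝓔.Ext n Y (X ⊞ X) := push biprod.inl x + push biprod.inr y
  have hx : push biprod.fst z = x := by simp [z, push_add, push_push, push_zero_mor]
  have hy : push biprod.snd z = y := by simp [z, push_add, push_push, push_zero_mor]
  rw [← hx, ← hy, push_add_push, hT, hT, hT, ha]

end Ext

namespace YonedaExtension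

variable {Z E Y : C} {i : Z ⟶ E} {p : E ⟶ Y}

/-- The class of the extension obtained by splicing an extension of `Z` with a conflation
`Z ⟶ E ⟶ Y`; in degree `0` this is the push-out of the conflation along a morphism. -/
noncomputable def connecting (h : 𝓔.IsConflation i p) {X : C} :
    {n : ℕ} → 𝓔.YonedaExtension X n Z → 𝓔.Ext (n + 1) Y X
  | 0, .hom g => Ext.push g (Ext.mk (.single i p h))
  | _ + 1, ξ => Ext.mk (.splice i p h ξ)

lemma HasMor.push_connecting_eq_pull_connecting {n : ℕ} (h : 𝓔.IsConflation i p) {Z' E' Y' : C}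
    {i' : Z' ⟶ E'} {p' : E' ⟶ Y'} (h' : 𝓔.IsConflation i' p') {ζ : Z ⟶ Z'} {γ : E ⟶ E'}
    {β : Y ⟶ Y'} (h₁ : i ≫ γ = ζ ≫ i') (h₂ : p ≫ β = γ ≫ p') {X X' : C} {α : X ⟶ X'}
    {ξ : 𝓔.YonedaExtension X n Z} {ξ' : 𝓔.YonedaExtension X' n Z'} (H : HasMor α ξ ξ' ζ) :
    Ext.push α (ξ.connecting h) = Ext.pull β (ξ'.connecting h') := by
  cases n with
  | zero =>
    obtain _ | _ | _ := ξ
    obtain _ | _ | _ := ξ'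
    simp only [HasMor] at H
    have hζ : HasMor ζ (.single i p h) (.single i' p' h') β := ⟨γ, h₁, h₂⟩
    simp only [YonedaExtension.connecting]
    rw [Ext.push_push, H, ← Ext.push_push, Ext.push_mk_eq_pull_mk hζ, Ext.push_pull]
  | succ n => exact Ext.push_mk_eq_pull_mk ⟨ζ, γ, h₁, h₂, H⟩

end YonedaExtension

namespace Ext

variable {n : ℕ} {Z E Y : C} {i : Z ⟶ E} {p : E ⟶ Y}

/-- The connecting map `Extⁿ(Z, X) → Extⁿ⁺¹(Y, X)` of a conflation `Z ⟶ E ⟶ Y`. -/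
noncomputable def connecting (h : 𝓔.IsConflation i p) {X : C} :
    𝓔.Ext n Z X → 𝓔.Ext (n + 1) Y X :=
  Quot.lift (fun ξ => ξ.connecting h) fun ξ ξ' H => by
    simpa using H.push_connecting_eq_pull_connecting h h (γ := 𝟙 _) (β := 𝟙 _) (by simp) (by simp)

lemma connecting_mk_hom (h : 𝓔.IsConflation i p) {X : C} (f : Z ⟶ X) :
    connecting h (mk (.hom f)) = push f (mk (.single i p h)) := rfl

lemma connecting_mk_id (h : 𝓔.IsConflation i p) :
    connecting h (mk (.hom (𝟙 Z))) = mk (.single i p h) := by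
  rw [connecting_mk_hom, push_id]

lemma push_connecting (h : 𝓔.IsConflation i p) {X X' : C} (α : X ⟶ X') (x : 𝓔.Ext n Z X) :
    push α (connecting h x) = connecting h (push α x) := by
  obtain ⟨ξ, rfl⟩ := exists_mk x
  obtain ⟨η, hη, H⟩ := exists_push_mk α ξ
  rw [hη, ← pull_id (connecting h (mk η))]
  exact H.push_connecting_eq_pull_connecting h h (γ := 𝟙 _) (by simp) (by simp)

lemma connecting_pull (h : 𝓔.IsConflation i p) {Z' E' Y' : C} {i' : Z' ⟶ E'} {p' : E' ⟶ Y'}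
    (h' : 𝓔.IsConflation i' p') {ζ : Z ⟶ Z'} {γ : E ⟶ E'} {β : Y ⟶ Y'}
    (h₁ : i ≫ γ = ζ ≫ i') (h₂ : p ≫ β = γ ≫ p') {X : C} (x : 𝓔.Ext n Z' X) :
    connecting h (pull ζ x) = pull β (connecting h' x) := by
  obtain ⟨ξ, rfl⟩ := exists_mk x
  obtain ⟨η, hη, H⟩ := exists_pull_mk ζ ξ
  rw [hη, ← push_id (connecting h (mk η))]
  exact H.push_connecting_eq_pull_connecting h h' h₁ h₂

lemma connecting_pull_of_refines (h : 𝓔.IsConflation i p) {Z' E' : C} {i' : Z' ⟶ E'}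
    {p' : E' ⟶ Y} (h' : 𝓔.IsConflation i' p') {ζ : Z ⟶ Z'} {γ : E ⟶ E'}
    (h₁ : i ≫ γ = ζ ≫ i') (h₂ : p = γ ≫ p') {X : C} (x : 𝓔.Ext n Z' X) :
    connecting h (pull ζ x) = connecting h' x := by
  rw [connecting_pull h h' h₁ (β := 𝟙 _) (by simpa using h₂), pull_id]

lemma exists_connecting {X Y : C} (x : 𝓔.Ext (n + 1) Y X) :
    ∃ (Z E : C) (i : Z ⟶ E) (p : E ⟶ Y) (h : 𝓔.IsConflation i p) (x' : 𝓔.Ext n Z X),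
      connecting h x' = x := by
  obtain ⟨_ | ⟨i, p, h⟩ | ⟨i, p, h, ξ⟩, rfl⟩ := exists_mk x
  · exact ⟨_, _, i, p, h, mk (.hom (𝟙 _)), connecting_mk_id h⟩
  · exact ⟨_, _, i, p, h, mk ξ, rfl⟩

variable [HasBinaryBiproducts C] [HasZeroObject C]

lemma connecting_add (h : 𝓔.IsConflation i p) {X : C} (x y : 𝓔.Ext n Z X) :
    connecting h (x + y) = connecting h x + connecting h y :=
  map_add_of_natural push_add_push (T := fun _ => connecting h)
    (fun α x => (push_connecting h α x).symm) x y

/-- `connecting` as a homomorphism of groups. -/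
noncomputable def connectingHom (h : 𝓔.IsConflation i p) (X : C) (n : ℕ) :
    𝓔.Ext n Z X →+ 𝓔.Ext (n + 1) Y X :=
  AddMonoidHom.mk' (connecting h) (connecting_add h)

lemma connecting_pull_self (h : 𝓔.IsConflation i p) {X : C} (m : 𝓔.Ext n E X) :
    connecting h (pull i m) = 0 := by
  rw [connecting_pull h (𝓔.isConflation_split E Y) (γ := biprod.inl) (β := 0) rfl (by simp),
    pull_zero_mor]

lemma pull_connecting_self (h : 𝓔.IsConflation i p) {X : C} (x : 𝓔.Ext n Z X) :
    pull p (connecting h x) = 0 := by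
  have hs := 𝓔.isConflation_split Z E
  rw [← connecting_pull hs h (ζ := 𝟙 Z) (γ := biprod.desc i (𝟙 E)) (by simp)
      (by ext <;> simp [h.zero]),
    connecting_pull hs hs (γ := biprod.fst ≫ biprod.inl) (β := 0) (by simp) (by simp),
    pull_zero_mor]

lemma exists_pull_eq_zero {X Y : C} (x : 𝓔.Ext (n + 1) Y X) :
    ∃ (A E : C) (i : A ⟶ E) (p : E ⟶ Y), 𝓔.IsConflation i p ∧ pull p x = 0 := by
  obtain ⟨Z, E, i, p, h, x, rfl⟩ := exists_connecting x
  exact ⟨Z, E, i, p, h, pull_connecting_self h x⟩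

end Ext

end ExactStructure
end

section
variable {C : Type u} [Category.{v} C] [Preadditive C] [HasBinaryBiproducts C] [HasZeroObject C]
  {𝓔 : ExactStructure C}

namespace ExactStructure

open YonedaExtension

namespace Ext

variable {n : ℕ} {X Y Z E : C}

/-- A class on `Z` vanishes on a refinement of a conflation `Z ⟶ E ⟶ Y` if it is killed by the
left component of some morphism to that conflation from another conflation ending in `Y`. -/
def VanishesOnRefinement (𝓔 : ExactStructure C) {X Y Z E : C} (i : Z ⟶ E) (p : E ⟶ Y)
    (x : 𝓔.Ext n Z X) : Prop :=
  ∃ (Z' E' : C) (i' : Z' ⟶ E') (p' : E' ⟶ Y) (ζ : Z' ⟶ Z) (γ : E' ⟶ E),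
    𝓔.IsConflation i' p' ∧ i' ≫ γ = ζ ≫ i ∧ p' = γ ≫ p ∧ pull ζ x = 0

lemma VanishesOnRefinement.of_pull {Z₁ E₁ : C} {i : Z ⟶ E} {p : E ⟶ Y} {i₁ : Z₁ ⟶ E₁}
    {p₁ : E₁ ⟶ Y} {ζ : Z ⟶ Z₁} {γ : E ⟶ E₁} (h₁ : i ≫ γ = ζ ≫ i₁) (h₂ : p = γ ≫ p₁)
    {x : 𝓔.Ext n Z₁ X} (hx : VanishesOnRefinement 𝓔 i p (pull ζ x)) :
    VanishesOnRefinement 𝓔 i₁ p₁ x := by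
  obtain ⟨Z', E', i', p', ζ', γ', h', e₁, e₂, hx⟩ := hx
  exact ⟨Z', E', i', p', ζ' ≫ ζ, γ' ≫ γ, h', by rw [reassoc_of% e₁, h₁, Category.assoc],
    by rw [e₂, h₂, Category.assoc], by rw [← pull_pull, hx]⟩

/-- Pull the given refinement back to `E`. The two resulting maps to `E₁` differ by a morphism into
`Z₁`, and the class becomes zero along that difference after passing to a further deflation. -/
lemma VanishesOnRefinement.exists_deflation {Z₁ E₁ : C} {i₁ : Z₁ ⟶ E₁} {p₁ : E₁ ⟶ Y}
    (h₁ : 𝓔.IsConflation i₁ p₁) {x : 𝓔.Ext (n + 1) Z₁ X} (hx : VanishesOnRefinement 𝓔 i₁ p₁ x)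
    {i : Z ⟶ E} {p : E ⟶ Y} (h : 𝓔.IsConflation i p) {ζ : Z ⟶ Z₁} {γ : E ⟶ E₁}
    (e₁ : i ≫ γ = ζ ≫ i₁) (e₂ : p = γ ≫ p₁) :
    ∃ (K G : C) (k : K ⟶ G) (a : K ⟶ Z) (g : G ⟶ E), 𝓔.IsConflation k (g ≫ p) ∧
      k ≫ g = a ≫ i ∧ pull a (pull ζ x) = 0 ∧ IsDeflationFor 𝓔.conflation g := by
  obtain ⟨Z', E', i', p', ζ', γ', h', e₁', e₂', hx⟩ := hx
  have := h₁.mono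
  obtain ⟨B, f, j, q, sq, hj, -⟩ := h'.exists_pullback p
  obtain ⟨s, hs⟩ := h₁.exists_lift (q ≫ γ - f ≫ γ') (by
    rw [Preadditive.sub_comp, Category.assoc, Category.assoc, ← e₂, ← e₂', sq.w, sub_self])
  obtain ⟨_, G, _, r, hr, hrx⟩ := exists_pull_eq_zero (pull s x)
  obtain ⟨_, _, hrq⟩ := hr.exists_comp hj
  obtain ⟨K, k, hk⟩ := hrq.exists_comp h
  obtain ⟨a, ha⟩ := h.exists_lift (k ≫ r ≫ q) (by simpa using hk.zero)
  obtain ⟨b, hb⟩ := h'.exists_lift (k ≫ r ≫ f) (by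
    simp only [Category.assoc, sq.w]; simpa using hk.zero)
  refine ⟨K, G, k, a, r ≫ q, hk, ha.symm, ?_, hrq.deflation⟩
  have hζ : a ≫ ζ = b ≫ ζ' + k ≫ r ≫ s := by
    rw [← cancel_mono i₁, Category.assoc, ← e₁, reassoc_of% ha, Preadditive.add_comp,
      Category.assoc, ← e₁', reassoc_of% hb, Category.assoc, Category.assoc, hs]
    simp
  rw [pull_pull, hζ, ← pull_add_pull, ← pull_pull, hx, ← pull_pull k, ← pull_pull r, hrx]
  simp only [pull_zero, add_zero]

lemma VanishesOnRefinement.pull {Z₁ E₁ : C} {i₁ : Z₁ ⟶ E₁} {p₁ : E₁ ⟶ Y}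
    (h₁ : 𝓔.IsConflation i₁ p₁) {x : 𝓔.Ext (n + 1) Z₁ X} (hx : VanishesOnRefinement 𝓔 i₁ p₁ x)
    {i : Z ⟶ E} {p : E ⟶ Y} (h : 𝓔.IsConflation i p) {ζ : Z ⟶ Z₁} {γ : E ⟶ E₁}
    (e₁ : i ≫ γ = ζ ≫ i₁) (e₂ : p = γ ≫ p₁) :
    VanishesOnRefinement 𝓔 i p (Ext.pull ζ x) := by
  obtain ⟨K, G, k, a, g, hk, e, hax, -⟩ := hx.exists_deflation h₁ h e₁ e₂
  exact ⟨K, G, k, g ≫ p, a, g, hk, e, rfl, hax⟩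

end Ext

namespace YonedaExtension

/-- The extension obtained by removing the conflation `Z ⟶ E ⟶ Y` at the right end becomes trivial
on a refinement of that conflation. Unlike the class of the truncated extension, this only depends
on the class of the whole extension, so that it detects the vanishing of spliced classes. -/
def TruncationVanishesOnRefinement {n : ℕ} {X Y : C} : 𝓔.YonedaExtension X (n + 2) Y → Prop
  | .splice i p _ ξ => Ext.VanishesOnRefinement 𝓔 i p (Ext.mk ξ)

lemma HasMor.truncationVanishesOnRefinement_iff {n : ℕ} {X Y : C}
    {ξ η : 𝓔.YonedaExtension X (n + 2) Y} (H : HasMor (𝟙 X) ξ η (𝟙 Y)) :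
    ξ.TruncationVanishesOnRefinement ↔ η.TruncationVanishesOnRefinement := by
  obtain _ | _ | ⟨i, p, h, ξ⟩ := ξ
  obtain _ | _ | ⟨i₁, p₁, h₁, η⟩ := η
  obtain ⟨ζ, γ, e₁, e₂, H⟩ := H
  rw [Category.comp_id] at e₂
  simp only [TruncationVanishesOnRefinement, ← Ext.pull_mk_eq H]
  exact ⟨fun hx => hx.of_pull e₁ e₂, fun hx => hx.pull h₁ h e₁ e₂⟩

end YonedaExtension

namespace Ext

variable {n : ℕ} {X Y Z E : C} {i : Z ⟶ E} {p : E ⟶ Y}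

lemma vanishesOnRefinement_of_connecting_eq_zero (h : 𝓔.IsConflation i p)
    (x : 𝓔.Ext (n + 1) Z X) (hx : connecting h x = 0) : VanishesOnRefinement 𝓔 i p x := by
  obtain ⟨ξ, rfl⟩ := exists_mk x
  have h_trivial : (trivial 𝓔 X (n + 2) Y).TruncationVanishesOnRefinement :=
    ⟨_, _, 0, 𝟙 Y, 𝟙 _, 𝟙 _, 𝓔.isConflation_zero_id (isZero_zero C) Y, by simp, by simp,
      pull_zero _⟩
  have h_iff : (splice i p h ξ).TruncationVanishesOnRefinement =
      (trivial 𝓔 X (n + 2) Y).TruncationVanishesOnRefinement :=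
    congrArg (Quot.lift TruncationVanishesOnRefinement fun _ _ H =>
      propext H.truncationVanishesOnRefinement_iff) hx
  exact h_iff.mpr h_trivial

lemma exists_retraction_of_mk_eq_zero {i : X ⟶ E} (h : 𝓔.IsConflation i p)
    (hx : mk (.single i p h) = 0) : ∃ r : E ⟶ X, i ≫ r = 𝟙 X :=
  (isSplit_iff_of_mk_eq (η := trivial 𝓔 X 1 Y) hx).2 ⟨biprod.fst, by simp⟩

lemma exists_extension (h : 𝓔.IsConflation i p) (f : Z ⟶ X)
    (hf : push f (mk (.single i p h)) = 0) : ∃ g : E ⟶ X, i ≫ g = f := by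
  obtain ⟨η, hη, H⟩ := exists_push_mk f (.single i p h)
  obtain _ | ⟨i', p', h'⟩ | _ := η
  obtain ⟨γ, e₁, -⟩ := H
  obtain ⟨r, hr⟩ := exists_retraction_of_mk_eq_zero h' (hη ▸ hf)
  exact ⟨γ ≫ r, by rw [reassoc_of% e₁, hr, Category.comp_id]⟩

variable (𝓔) in
/-- Exactness of `Extⁿ(E, X) ⟶ Extⁿ(Z, X) ⟶ Extⁿ⁺¹(Y, X)` for all conflations `Z ⟶ E ⟶ Y`. -/
def ExactAtSub (n : ℕ) : Prop :=
  ∀ {X Y Z E : C} {i : Z ⟶ E} {p : E ⟶ Y} (h : 𝓔.IsConflation i p) (x : 𝓔.Ext n Z X),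
    connecting h x = 0 → ∃ m : 𝓔.Ext n E X, pull i m = x

variable (𝓔) in
/-- Exactness of `Extⁿ(Z, X) ⟶ Extⁿ⁺¹(Y, X) ⟶ Extⁿ⁺¹(E, X)` for all conflations `Z ⟶ E ⟶ Y`. -/
def ExactAtQuotient (n : ℕ) : Prop :=
  ∀ {X Y Z E : C} {i : Z ⟶ E} {p : E ⟶ Y} (h : 𝓔.IsConflation i p) (x : 𝓔.Ext (n + 1) Y X),
    pull p x = 0 → ∃ x' : 𝓔.Ext n Z X, connecting h x' = x

lemma exactAtSub_zero : ExactAtSub 𝓔 0 := by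
  intro X Y Z E i p h x hx
  obtain ⟨f, rfl⟩ := mk_hom_surjective _ _ x
  obtain ⟨g, rfl⟩ := exists_extension h f hx
  exact ⟨mk (.hom g), pull_mk_hom _ _⟩

/-- Write `x` as `connecting k x₁` for a conflation `W ⟶ F ⟶ Y` and pull it back to `E`. There
`x₁` extends to a class `m` on the pull-back `G` of `F` and `E` over `Y`, which contains `Z`. -/
lemma ExactAtSub.exactAtQuotient (H : ExactAtSub 𝓔 n) : ExactAtQuotient 𝓔 n := by
  intro X Y Z E i p h x hx
  obtain ⟨W, F, j, q, k, x₁, rfl⟩ := exists_connecting x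
  obtain ⟨G, f, w, q', sq, k', hwf⟩ := k.exists_pullback p
  have hx₁ : connecting k' x₁ = 0 := by
    rw [← hx, ← connecting_pull k' k (ζ := 𝟙 _) (by simpa using hwf) sq.w.symm, pull_id]
  obtain ⟨m, rfl⟩ := H k' x₁ hx₁
  obtain ⟨K, κ, hκ⟩ := k'.exists_comp h
  have hκ₀ : κ ≫ q' ≫ p = 0 := hκ.zero
  obtain ⟨a, ha⟩ := k.exists_lift (κ ≫ f) (by rw [Category.assoc, sq.w, hκ₀])
  obtain ⟨b, hb⟩ := h.exists_lift (κ ≫ q') (by rw [Category.assoc, hκ₀])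
  let z : Z ⟶ G := sq.lift 0 i (by rw [h.zero, zero_comp])
  have hz : a ≫ w = κ + b ≫ (-z) := by
    refine sq.hom_ext ?_ ?_
    · simp [z, hwf, ha]
    · simp [z, k'.zero, hb]
  refine ⟨pull (-z) m, ?_⟩
  rw [← connecting_pull_of_refines hκ k ha.symm sq.w.symm, pull_pull, hz, ← pull_add_pull,
    connecting_add, connecting_pull_self, zero_add, ← pull_pull,
    connecting_pull_of_refines hκ h hb.symm rfl]

lemma ExactAtQuotient.exactAtSub_succ (H : ExactAtQuotient 𝓔 n) : ExactAtSub 𝓔 (n + 1) := by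
  intro X Y Z E i p h x hx
  obtain ⟨K, G, k, a, g, hk, ha, hax, D, j, w, hj⟩ :=
    (vanishesOnRefinement_of_connecting_eq_zero h x hx).exists_deflation h h (ζ := 𝟙 Z)
      (γ := 𝟙 E) (by simp) (by simp)
  have hj : 𝓔.IsConflation j g := ⟨w, hj⟩
  obtain ⟨B, f, j', q, sq, hj', hjf⟩ := hj.exists_pullback i
  obtain ⟨b, hb⟩ := hk.exists_lift f (by rw [reassoc_of% sq.w, h.zero, comp_zero])
  have := h.mono
  have hbq : b ≫ a = q := by
    rw [← cancel_mono i, Category.assoc, ← ha, reassoc_of% hb, sq.w]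
  rw [pull_id] at hax
  obtain ⟨x', rfl⟩ := H hj' x (by rw [← hbq, ← pull_pull, hax, pull_zero])
  refine ⟨connecting hj x', ?_⟩
  rw [← connecting_pull hj' hj (ζ := 𝟙 _) (by simpa using hjf) sq.w.symm, pull_id]

lemma exactAtSub : ∀ n : ℕ, ExactAtSub 𝓔 n
  | 0 => exactAtSub_zero
  | n + 1 => ExactAtQuotient.exactAtSub_succ (ExactAtSub.exactAtQuotient (exactAtSub n))

lemma exactAtQuotient (n : ℕ) : ExactAtQuotient 𝓔 n :=
  ExactAtSub.exactAtQuotient (exactAtSub n)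

end Ext

end ExactStructure
end

section
variable {C : Type u} [Category.{v} C]

/-- The morphisms from objects of `M` lift along `p`. -/
def LiftsFrom (M : ObjectProperty C) {B Z : C} (p : B ⟶ Z) : Prop :=
  ∀ N : C, M N → Function.Surjective fun g : N ⟶ B => g ≫ p

namespace LiftsFrom

variable {M : ObjectProperty C} {B B' Z Z' : C} {p : B ⟶ Z}

lemma of_comp_eq (hp : LiftsFrom M p) {f : B ⟶ B'} {p' : B' ⟶ Z} (h : f ≫ p' = p) :
    LiftsFrom M p' := fun N hN g => by
  obtain ⟨e, rfl⟩ := hp N hN g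
  exact ⟨e ≫ f, by simp only [Category.assoc, h]⟩

lemma of_isPullback (hp : LiftsFrom M p) {f' : B' ⟶ B} {p' : B' ⟶ Z'} {f : Z' ⟶ Z}
    (sq : IsPullback f' p' p f) : LiftsFrom M p' := fun N hN g => by
  obtain ⟨e, he⟩ := hp N hN (g ≫ f)
  exact ⟨sq.lift e g he, sq.lift_snd _ _ _⟩

lemma of_comp_eq_id {s : Z ⟶ B} (h : s ≫ p = 𝟙 Z) : LiftsFrom M p := fun _ _ g =>
  ⟨g ≫ s, by simp only [Category.assoc, h, Category.comp_id]⟩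

end LiftsFrom

end

section
variable {C : Type u} [Category.{v} C] [Preadditive C] {𝓔 : ExactStructure C}

namespace ExactStructure

/-- The morphism of short complexes given by a morphism of conflations. -/
def IsConflation.homMk {X E Z X' E' Z' : C} {i : X ⟶ E} {p : E ⟶ Z} (h : 𝓔.IsConflation i p)
    {i' : X' ⟶ E'} {p' : E' ⟶ Z'} (h' : 𝓔.IsConflation i' p') {α : X ⟶ X'} {γ : E ⟶ E'}
    {β : Z ⟶ Z'} (h₁ : i ≫ γ = α ≫ i') (h₂ : p ≫ β = γ ≫ p') :
    ShortComplex.mk i p h.zero ⟶ ShortComplex.mk i' p' h'.zero where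
  τ₁ := α
  τ₂ := γ
  τ₃ := β
  comm₁₂ := h₁.symm
  comm₂₃ := h₂.symm

section Abelian

variable {A : Type u'} [Category.{v'} A] [Abelian A] {M : ObjectProperty C}
  {F : C ⥤ A} [F.Additive]

variable (𝓔 M F) in
/-- The properties of the restricted Yoneda functor `X ↦ Hom(-, X)|_M` that the comparison of
extension groups relies on. -/
structure IsRestrictedYoneda : Prop where
  map_bijective {N : C} (hN : M N) (Y : C) :
    Function.Bijective (F.map : (N ⟶ Y) → (F.obj N ⟶ F.obj Y))
  projective {N : C} (hN : M N) : Projective (F.obj N)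
  shortExact {X B Z : C} {i : X ⟶ B} {p : B ⟶ Z} (h : 𝓔.IsConflation i p) (hp : LiftsFrom M p) :
    ((ShortComplex.mk i p h.zero).map F).ShortExact

namespace IsRestrictedYoneda

variable (hF : IsRestrictedYoneda 𝓔 M F)
include hF

lemma liftsFrom {X B Z : C} {i : X ⟶ B} {p : B ⟶ Z} (h : 𝓔.IsConflation i p)
    (hS : ((ShortComplex.mk i p h.zero).map F).ShortExact) : LiftsFrom M p := fun N hN g => by
  have := hF.projective hN
  have : Epi (F.map p) := hS.epi_g
  obtain ⟨e, he⟩ := (hF.map_bijective hN B).2 (Projective.factorThru (F.map g) (F.map p))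
  exact ⟨e, (hF.map_bijective hN Z).1 (by rw [F.map_comp, he, Projective.factorThru_comp])⟩

lemma map_bijective_of_conflation {X Y M₀ Z M₁ Z' : C} {i : Z ⟶ M₀} {p : M₀ ⟶ Y}
    (h : 𝓔.IsConflation i p) {i' : Z' ⟶ M₁} {p' : M₁ ⟶ Z} (h' : 𝓔.IsConflation i' p')
    (h₀ : M M₀) (h₁ : M M₁) (hp : LiftsFrom M p) :
    Function.Bijective (F.map : (Y ⟶ X) → (F.obj Y ⟶ F.obj X)) := by
  have := h.epi
  have := h'.epi
  have : Epi (F.map p) := (hF.shortExact h hp).epi_g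
  refine ⟨fun f f' e => ?_, fun α => ?_⟩
  · rw [← cancel_epi p]
    exact (hF.map_bijective h₀ X).1 (by simp only [F.map_comp, e])
  · obtain ⟨g, hg⟩ := (hF.map_bijective h₀ X).2 (F.map p ≫ α)
    have hg₀ : i ≫ g = 0 := by
      rw [← cancel_epi p', comp_zero]
      apply (hF.map_bijective h₁ X).1
      rw [F.map_comp, F.map_comp, hg, ← F.map_comp_assoc i, h.zero]
      simp only [F.map_zero, zero_comp, comp_zero]
    obtain ⟨f, hf⟩ := h.exists_desc g hg₀
    exact ⟨f, by rw [← cancel_epi (F.map p), ← F.map_comp, hf, hg]⟩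

lemma exists_pushout {X X' Y : C} {n : ℕ} {ξ : 𝓔.YonedaExtension X n Y} (hξ : ξ.MapExact F)
    (α : X ⟶ X') : ∃ η : 𝓔.YonedaExtension X' n Y,
      YonedaExtension.HasMor α ξ η (𝟙 Y) ∧ η.MapExact F := by
  induction ξ with
  | hom f => exact ⟨.hom (f ≫ α), (Category.id_comp _).symm, True.intro⟩
  | single i p h =>
    obtain ⟨B, f', i', p', sq, h', hp⟩ := h.exists_pushout α
    exact ⟨.single i' p' h', ⟨f', sq.w, by rw [hp, Category.comp_id]⟩,
      hF.shortExact h' ((hF.liftsFrom h hξ).of_comp_eq hp)⟩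
  | splice i p h ξ ih =>
    obtain ⟨η, hη, hη'⟩ := ih hξ.2
    exact ⟨.splice i p h η, ⟨𝟙 _, 𝟙 _, by simp, by simp, hη⟩, hξ.1, hη'⟩

lemma exists_pullback {X Y Y' : C} {n : ℕ} {ξ : 𝓔.YonedaExtension X n Y} (hξ : ξ.MapExact F)
    (β : Y' ⟶ Y) : ∃ η : 𝓔.YonedaExtension X n Y',
      YonedaExtension.HasMor (𝟙 X) η ξ β ∧ η.MapExact F := by
  cases ξ with
  | hom f => exact ⟨.hom (β ≫ f), Category.comp_id _, True.intro⟩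
  | single i p h =>
    obtain ⟨B, f', i', p', sq, h', hi⟩ := h.exists_pullback β
    exact ⟨.single i' p' h', ⟨f', by rw [hi, Category.id_comp], sq.w.symm⟩,
      hF.shortExact h' ((hF.liftsFrom h hξ).of_isPullback sq)⟩
  | splice i p h ξ =>
    obtain ⟨B, f', i', p', sq, h', hi⟩ := h.exists_pullback β
    exact ⟨.splice i' p' h' ξ,
      ⟨𝟙 _, f', by rw [hi, Category.id_comp], sq.w.symm, .id ξ⟩,
      hF.shortExact h' ((hF.liftsFrom h hξ.1).of_isPullback sq), hξ.2⟩

end IsRestrictedYoneda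

section Ext

variable [HasExt.{w} A]

variable (F) in
/-- The class in `Ext¹(F Z, F X)` of the image of a conflation `X ⟶ E ⟶ Z`. -/
noncomputable def mapExtClass {X E Z : C} {i : X ⟶ E} {p : E ⟶ Z}
    (h : 𝓔.IsConflation i p) (hS : ((ShortComplex.mk i p h.zero).map F).ShortExact) :
    Abelian.Ext.{w} (F.obj Z) (F.obj X) 1 := hS.extClass

lemma mapExtClass_naturality {X E Z X' E' Z' : C} {i : X ⟶ E}
    {p : E ⟶ Z} (h : 𝓔.IsConflation i p) {i' : X' ⟶ E'} {p' : E' ⟶ Z'}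
    (h' : 𝓔.IsConflation i' p') {α : X ⟶ X'} {γ : E ⟶ E'} {β : Z ⟶ Z'} (h₁ : i ≫ γ = α ≫ i')
    (h₂ : p ≫ β = γ ≫ p') (hS : ((ShortComplex.mk i p h.zero).map F).ShortExact)
    (hS' : ((ShortComplex.mk i' p' h'.zero).map F).ShortExact) :
    (mapExtClass F h hS).comp (.mk₀ (F.map α)) (add_zero 1) =
      (Abelian.Ext.mk₀ (F.map β)).comp (mapExtClass F h' hS') (zero_add 1) :=
  hS.extClass_naturality hS' (F.mapShortComplex.map (h.homMk h' h₁ h₂))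

namespace YonedaExtension

lemma mapClass_splice {X Z E Y : C} {n : ℕ} {i : Z ⟶ E} {p : E ⟶ Y}
    (h : 𝓔.IsConflation i p) (ξ : 𝓔.YonedaExtension X (n + 1) Z)
    (hξ : (splice i p h ξ).MapExact F) :
    (splice i p h ξ).mapClass F hξ =
      (mapExtClass F h hξ.1).comp (ξ.mapClass F hξ.2) (add_comm 1 (n + 1)) := rfl

lemma HasMor.mapClass {X X' : C} {α : X ⟶ X'} {n : ℕ} {Y : C}
    {ξ : 𝓔.YonedaExtension X n Y} {Y' : C} {β : Y ⟶ Y'} {η : 𝓔.YonedaExtension X' n Y'}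
    (H : HasMor α ξ η β) (hξ : ξ.MapExact F) (hη : η.MapExact F) :
    (ξ.mapClass F hξ).comp (.mk₀ (F.map α)) (add_zero n) =
      (Abelian.Ext.mk₀ (F.map β)).comp (η.mapClass F hη) (zero_add n) := by
  induction ξ generalizing Y' with
  | hom f =>
    obtain g | _ | _ := η
    simp only [HasMor] at H
    simp only [YonedaExtension.mapClass, Abelian.Ext.mk₀_comp_mk₀, ← F.map_comp, H]
  | single i p h =>
    obtain _ | ⟨i', p', h'⟩ | _ := η
    obtain ⟨γ, h₁, h₂⟩ := H
    exact mapExtClass_naturality h h' h₁ h₂ hξ hη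
  | splice i p h ξ ih =>
    obtain _ | _ | ⟨i', p', h', η⟩ := η
    obtain ⟨ζ, γ, h₁, h₂, H⟩ := H
    rw [mapClass_splice, mapClass_splice,
      Abelian.Ext.comp_assoc _ _ _ (add_comm 1 _) (add_zero _) (add_comm 1 _), ih H hξ.2 hη.2,
      ← Abelian.Ext.comp_assoc _ _ _ (add_zero 1) (zero_add _) (add_comm 1 _),
      mapExtClass_naturality h h' h₁ h₂ hξ.1 hη.1,
      Abelian.Ext.comp_assoc _ _ _ (zero_add 1) (add_comm 1 _) (by lia)]

end YonedaExtension

variable (F) in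
/-- The class `y` is the class of the image under `F` of an extension representing `x` whose image
is exact. -/
def IsImageClass {n : ℕ} {X Y : C} (x : 𝓔.Ext n Y X)
    (y : Abelian.Ext.{w} (F.obj Y) (F.obj X) n) : Prop :=
  ∃ (ξ : 𝓔.YonedaExtension X n Y) (hξ : ξ.MapExact F), Ext.mk ξ = x ∧ ξ.mapClass F hξ = y

namespace IsImageClass

variable {n : ℕ}

lemma hom_iff {X Y : C} (f : Y ⟶ X) (y : Abelian.Ext.{w} (F.obj Y) (F.obj X) 0) :
    IsImageClass F (Ext.mk (.hom f) : 𝓔.Ext 0 Y X) y ↔ .mk₀ (F.map f) = y := by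
  constructor
  · rintro ⟨_ | _ | _, hξ, h, rfl⟩
    rw [← Ext.mk_hom_injective Y X h]
    rfl
  · rintro rfl
    exact ⟨.hom f, True.intro, rfl, rfl⟩

lemma push (hF : IsRestrictedYoneda 𝓔 M F) {X X' Y : C} {x : 𝓔.Ext n Y X}
    {y : Abelian.Ext.{w} (F.obj Y) (F.obj X) n} (H : IsImageClass F x y) (f : X ⟶ X') :
    IsImageClass F (Ext.push f x) (y.comp (.mk₀ (F.map f)) (add_zero n)) := by
  obtain ⟨ξ, hξ, rfl, rfl⟩ := H
  obtain ⟨η, h, hη⟩ := hF.exists_pushout hξ f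
  refine ⟨η, hη, (Ext.push_mk_eq h).symm, ?_⟩
  rw [h.mapClass hξ hη, CategoryTheory.Functor.map_id, Abelian.Ext.mk₀_id_comp]

lemma pull (hF : IsRestrictedYoneda 𝓔 M F) {X Y Y' : C} {x : 𝓔.Ext n Y X}
    {y : Abelian.Ext.{w} (F.obj Y) (F.obj X) n} (H : IsImageClass F x y) (g : Y' ⟶ Y) :
    IsImageClass F (Ext.pull g x) ((Abelian.Ext.mk₀ (F.map g)).comp y (zero_add n)) := by
  obtain ⟨ξ, hξ, rfl, rfl⟩ := H
  obtain ⟨η, h, hη⟩ := hF.exists_pullback hξ g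
  refine ⟨η, hη, (Ext.pull_mk_eq h).symm, ?_⟩
  rw [← h.mapClass hη hξ, CategoryTheory.Functor.map_id, Abelian.Ext.comp_mk₀_id]

variable {X Z E Y : C} {i : Z ⟶ E} {p : E ⟶ Y} (h : 𝓔.IsConflation i p)
  (hS : ((ShortComplex.mk i p h.zero).map F).ShortExact)

lemma connecting (hF : IsRestrictedYoneda 𝓔 M F) {x : 𝓔.Ext n Z X}
    {y : Abelian.Ext.{w} (F.obj Z) (F.obj X) n} (H : IsImageClass F x y) :
    IsImageClass F (Ext.connecting h x) ((mapExtClass F h hS).comp y (add_comm 1 n)) := by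
  obtain ⟨ξ, hξ, rfl, rfl⟩ := H
  cases n with
  | zero =>
    obtain ⟨f⟩ | _ | _ := ξ
    exact push hF ⟨.single i p h, hS, rfl, rfl⟩ f
  | succ n => exact ⟨.splice i p h ξ, ⟨hS, hξ⟩, rfl, rfl⟩

/-- The projection of a conflation with middle term in `M` factors through the last deflation of
every extension whose image is exact. -/
lemma exists_connecting (hF : IsRestrictedYoneda 𝓔 M F) (hE : M E) {x : 𝓔.Ext (n + 1) Y X}
    {y : Abelian.Ext.{w} (F.obj Y) (F.obj X) (n + 1)} (H : IsImageClass F x y) :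
    ∃ (x' : 𝓔.Ext n Z X) (y' : Abelian.Ext.{w} (F.obj Z) (F.obj X) n),
      IsImageClass F x' y' ∧ Ext.connecting h x' = x ∧
        (mapExtClass F h hS).comp y' (add_comm 1 n) = y := by
  obtain ⟨ξ, hξ, rfl, rfl⟩ := H
  cases n with
  | zero =>
    obtain _ | ⟨j, q, k⟩ | _ := ξ
    obtain ⟨γ, hγ⟩ : ∃ γ, γ ≫ q = p := hF.liftsFrom k hξ E hE p
    obtain ⟨f, hf⟩ := k.exists_lift (i ≫ γ) (by rw [Category.assoc, hγ, h.zero])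
    have hf' : YonedaExtension.HasMor f (.single i p h) (.single j q k) (𝟙 Y) :=
      ⟨γ, hf.symm, by rw [hγ, Category.comp_id]⟩
    refine ⟨Ext.mk (.hom f), _, (hom_iff f _).2 rfl, Ext.push_mk_eq hf', ?_⟩
    have := hf'.mapClass (F := F) hS hξ
    rw [CategoryTheory.Functor.map_id, Abelian.Ext.mk₀_id_comp] at this
    exact this
  | succ n =>
    obtain _ | _ | ⟨j, q, k, ξ⟩ := ξ
    obtain ⟨γ, hγ⟩ : ∃ γ, γ ≫ q = p := hF.liftsFrom k hξ.1 E hE p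
    obtain ⟨ζ, hζ⟩ := k.exists_lift (i ≫ γ) (by rw [Category.assoc, hγ, h.zero])
    refine ⟨_, _, pull hF ⟨ξ, hξ.2, rfl, rfl⟩ ζ,
      Ext.connecting_pull_of_refines h k hζ.symm hγ.symm _, ?_⟩
    have := mapExtClass_naturality h k hζ.symm (β := 𝟙 Y)
      (by rw [hγ, Category.comp_id]) hS hξ.1
    rw [CategoryTheory.Functor.map_id, Abelian.Ext.mk₀_id_comp] at this
    rw [← Abelian.Ext.comp_assoc _ _ _ (add_zero 1) (zero_add _) (by lia), this]
    rfl

end IsImageClass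

end Ext

end Abelian

end ExactStructure
end

lemma exists_addEquiv_of_surjective {A A' B B' : Type*} [AddGroup A] [AddGroup A'] [AddGroup B]
    [AddGroup B'] {g : A →+ A'} (hg : Function.Surjective g) {g' : B →+ B'}
    (hg' : Function.Surjective g') (e : A ≃+ B) (h : ∀ a, g a = 0 ↔ g' (e a) = 0) :
    ∃ e' : A' ≃+ B', ∀ a, e' (g a) = g' (e a) := by
  have hker : g.ker.map e.toAddMonoidHom = g'.ker := by
    ext b
    obtain ⟨a, rfl⟩ := e.surjective b
    simp [AddMonoidHom.mem_ker, h]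
  refine ⟨(QuotientAddGroup.quotientKerEquivOfSurjective g hg).symm.trans
    ((QuotientAddGroup.congr _ _ e hker).trans
      (QuotientAddGroup.quotientKerEquivOfSurjective g' hg')), fun a => ?_⟩
  have ha : (QuotientAddGroup.quotientKerEquivOfSurjective g hg).symm (g a) = (a : A ⧸ g.ker) :=
    (AddEquiv.symm_apply_eq _).2 rfl
  rw [AddEquiv.trans_apply, AddEquiv.trans_apply, ha]
  rfl

section
variable {C : Type u} [Category.{v} C] [Preadditive C] [HasZeroObject C] [HasBinaryBiproducts C]
  {𝓔 : ExactStructure C} {M : ObjectProperty C}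

namespace ExactStructure

variable {A : Type u'} [Category.{v'} A] [Abelian A] [HasExt.{w} A] {F : C ⥤ A} [F.Additive]

variable (𝓔 F) in
/-- The functor `F` induces a well-defined isomorphism `Extⁿ(Y, X) ≃ Extⁿ(F Y, F X)`: every class is
represented by an extension whose image is exact, and is sent to the class of any such image. -/
def InducesExtIso (n : ℕ) (Y X : C) : Prop :=
  ∃ e : 𝓔.Ext n Y X ≃+ Abelian.Ext.{w} (F.obj Y) (F.obj X) n,
    ∀ x y, e x = y ↔ IsImageClass F x y

omit [HasZeroObject C] in
lemma inducesExtIso_zero {X Y : C}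
    (h : Function.Bijective (F.map : (Y ⟶ X) → (F.obj Y ⟶ F.obj X))) :
    InducesExtIso 𝓔 F 0 Y X := by
  refine ⟨(Ext.homAddEquiv Y X).symm.trans ((AddEquiv.ofBijective F.mapAddHom h).trans
    Abelian.Ext.addEquiv₀.symm), fun x y => ?_⟩
  obtain ⟨g, rfl⟩ := (Ext.homAddEquiv Y X).surjective x
  rw [AddEquiv.trans_apply, AddEquiv.symm_apply_apply]
  exact (IsImageClass.hom_iff g y).symm

namespace IsRestrictedYoneda

variable (hF : IsRestrictedYoneda 𝓔 M F)
include hF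

omit [HasExt.{w} A] in
lemma mapExact_trivial (X : C) : ∀ (n : ℕ) (Y : C), (YonedaExtension.trivial 𝓔 X n Y).MapExact F
  | 0, _ => True.intro
  | 1, _ => hF.shortExact (𝓔.isConflation_split X _) (.of_comp_eq_id biprod.inr_snd)
  | n + 2, _ => ⟨hF.shortExact (𝓔.isConflation_zero_id (isZero_zero C) _)
        (.of_comp_eq_id (Category.comp_id _)),
      mapExact_trivial X (n + 1) _⟩

lemma inducesExtIso_of_prop {N X : C} (hN : M N) {n : ℕ}
    (hX : 𝓔.rightExtOrthogonal M (n + 1) X) : InducesExtIso 𝓔 F n N X := by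
  cases n with
  | zero => exact inducesExtIso_zero (hF.map_bijective hN X)
  | succ n =>
    have := hF.projective hN
    refine ⟨⟨⟨0, 0, fun x => (hX _ (by lia) (by lia) N hN x).symm,
      fun y => y.eq_zero_of_projective.symm⟩, fun _ _ => (add_zero _).symm⟩, fun x y => ?_⟩
    exact iff_of_true y.eq_zero_of_projective.symm ⟨_, hF.mapExact_trivial X (n + 1) N,
      (hX _ (by lia) (by lia) N hN x).symm,
      (Abelian.Ext.eq_zero_of_projective _).trans y.eq_zero_of_projective.symm⟩

variable {n : ℕ} {X Y Z E : C} {i : Z ⟶ E} {p : E ⟶ Y} (h : 𝓔.IsConflation i p)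
  (hS : ((ShortComplex.mk i p h.zero).map F).ShortExact)

lemma connecting_eq_zero_iff (hE : InducesExtIso 𝓔 F n E X)
    {e : 𝓔.Ext n Z X ≃+ Abelian.Ext.{w} (F.obj Z) (F.obj X) n}
    (he : ∀ x y, e x = y ↔ IsImageClass F x y) (x : 𝓔.Ext n Z X) :
    Ext.connecting h x = 0 ↔ (mapExtClass F h hS).comp (e x) (add_comm 1 n) = 0 := by
  obtain ⟨e₀, he₀⟩ := hE
  have e_pull : ∀ m, e (Ext.pull i m) =
      (Abelian.Ext.mk₀ (F.map i)).comp (e₀ m) (zero_add n) :=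
    fun m => (he _ _).2 (((he₀ m _).1 rfl).pull hF i)
  constructor
  · intro hx
    obtain ⟨m, rfl⟩ := Ext.exactAtSub n h x hx
    rw [e_pull]
    exact hS.extClass_comp_assoc (h := add_comm 1 n) (e₀ m)
  · intro hx
    obtain ⟨y, hy⟩ := Abelian.Ext.contravariant_sequence_exact₁ hS _ (e x) (add_comm 1 n) hx
    obtain ⟨m, rfl⟩ := e₀.surjective y
    rw [e.injective (hy.symm.trans (e_pull m).symm), Ext.connecting_pull_self]

include h hS in
/-- The isomorphism in degree `n + 1` is the one induced on the cokernels of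
`Extⁿ(E, X) ⟶ Extⁿ(Z, X)` and of `Extⁿ(F E, F X) ⟶ Extⁿ(F Z, F X)`. -/
lemma inducesExtIso_succ (hME : M E) (hZ : InducesExtIso 𝓔 F n Z X)
    (hE : InducesExtIso 𝓔 F n E X) (hX : ∀ x : 𝓔.Ext (n + 1) E X, x = 0) :
    InducesExtIso 𝓔 F (n + 1) Y X := by
  obtain ⟨e, he⟩ := hZ
  have : Projective ((ShortComplex.mk i p h.zero).map F).X₂ := hF.projective hME
  have connecting_surjective (x : 𝓔.Ext (n + 1) Y X) : ∃ x', Ext.connecting h x' = x :=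
    Ext.exactAtQuotient n h x (hX _)
  obtain ⟨e', he'⟩ := exists_addEquiv_of_surjective
    (g := Ext.connectingHom h X n) connecting_surjective
    (g' := (mapExtClass F h hS).precomp (F.obj X) (add_comm 1 n))
    (fun y => Abelian.Ext.contravariant_sequence_exact₃ hS _ y (Abelian.Ext.eq_zero_of_projective _)
      (add_comm 1 n)) e (hF.connecting_eq_zero_iff h hS hE he)
  refine ⟨e', fun x y => ⟨?_, fun hxy => ?_⟩⟩
  · rintro rfl
    obtain ⟨x, rfl⟩ := connecting_surjective x
    exact (he' x).symm ▸ ((he _ _).1 rfl).connecting h hS hF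
  · obtain ⟨x', y', hxy', rfl, rfl⟩ := hxy.exists_connecting h hS hF hME
    rw [← (he _ _).2 hxy']
    exact he' x'

end IsRestrictedYoneda

variable (𝓔 M) in
/-- There is an exact sequence `Mₖ₋₁ ⟶ ⋯ ⟶ M₀ ⟶ Y ⟶ 0` spliced from `k` conflations with middle
terms in `M`, along whose deflations the morphisms from objects of `M` lift. -/
def HasResolution : ℕ → C → Prop
  | 0, _ => True
  | k + 1, Y => ∃ (M₀ Z : C) (i : Z ⟶ M₀) (p : M₀ ⟶ Y),
      M M₀ ∧ 𝓔.IsConflation i p ∧ LiftsFrom M p ∧ HasResolution k Z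

omit [HasZeroObject C] [HasBinaryBiproducts C] in
lemma hasResolution_of_gen {k m : ℕ} {Y : C} (hY : 𝓔.gen M k Y) (hm : m ≤ k + 1) :
    HasResolution 𝓔 M m Y := by
  obtain ⟨Z, M', ι, π, rfl, hc, hex⟩ := hY
  have hπ : ∀ j ≤ k, LiftsFrom M (π j) := by
    rintro (_ | _ | j) hj N hN g
    · exact (hex N hN).1 g
    · have := (hc 0 (by lia)).2.mono
      obtain ⟨g', hg'⟩ := ((hex N hN).2.1 hj (g ≫ ι 0)).1 (by simp [(hc 0 (by lia)).2.zero])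
      exact ⟨g', by rw [← cancel_mono (ι 0)]; simpa using hg'⟩
    · have := (hc (j + 1) (by lia)).2.mono
      obtain ⟨g', hg'⟩ := ((hex N hN).2.2 j hj (g ≫ ι (j + 1))).1
        (by simp [reassoc_of% (hc (j + 1) (by lia)).2.zero])
      exact ⟨g', by rw [← cancel_mono (ι (j + 1))]; simpa using hg'⟩
  suffices ∀ m j, j + m ≤ k + 1 → HasResolution 𝓔 M m (Z j) from this m 0 (by lia)
  intro m
  induction m with
  | zero => exact fun _ _ => True.intro
  | succ m ih =>
    exact fun j hj => ⟨_, _, ι j, π j, (hc j (by lia)).1, (hc j (by lia)).2, hπ j (by lia),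
      ih (j + 1) (by lia)⟩

lemma rightExtOrthogonal_anti {k k' : ℕ} (hk : k ≤ k') {X : C}
    (hX : 𝓔.rightExtOrthogonal M k' X) : 𝓔.rightExtOrthogonal M k X :=
  fun i hi hik => hX i hi (hik.trans_le hk)

theorem IsRestrictedYoneda.inducesExtIso (hF : IsRestrictedYoneda 𝓔 M F) {n : ℕ} {X Y : C}
    (hY : HasResolution 𝓔 M (n + 2) Y) (hX : 𝓔.rightExtOrthogonal M (n + 1) X) :
    InducesExtIso 𝓔 F n Y X := by
  induction n generalizing Y with
  | zero =>
    obtain ⟨M₀, Z, i, p, h₀, h, hp, M₁, Z', i', p', h₁, h', -⟩ := hY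
    exact inducesExtIso_zero (hF.map_bijective_of_conflation h h' h₀ h₁ hp)
  | succ n ih =>
    obtain ⟨M₀, Z, i, p, h₀, h, hp, hZ⟩ := hY
    have hX' := rightExtOrthogonal_anti (Nat.le_succ _) hX
    exact hF.inducesExtIso_succ h (hF.shortExact h hp) h₀ (ih hZ hX')
      (hF.inducesExtIso_of_prop h₀ hX') (hX _ (by lia) (by lia) M₀ h₀)

end ExactStructure
end

section
variable {C : Type u} [Category.{v} C] [Preadditive C] {𝓔 : ExactStructure C}

namespace ExactStructure

lemma isInflationFor_unop_iff {K : ObjectProperty (ShortComplex C)} {A B : Cᵒᵖ} {i : A ⟶ B} :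
    IsInflationFor (fun S => K S.unop) i ↔ IsDeflationFor K i.unop :=
  ⟨fun ⟨Z, p, w, h⟩ => ⟨Z.unop, p.unop, congrArg Quiver.Hom.unop w, h⟩,
    fun ⟨Z, p, w, h⟩ => ⟨.op Z, p.op, congrArg Quiver.Hom.op w, h⟩⟩

lemma isDeflationFor_unop_iff {K : ObjectProperty (ShortComplex C)} {B Z : Cᵒᵖ} {p : B ⟶ Z} :
    IsDeflationFor (fun S => K S.unop) p ↔ IsInflationFor K p.unop :=
  ⟨fun ⟨A, i, w, h⟩ => ⟨A.unop, i.unop, congrArg Quiver.Hom.unop w, h⟩,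
    fun ⟨A, i, w, h⟩ => ⟨.op A, i.op, congrArg Quiver.Hom.op w, h⟩⟩

/-- The opposite exact structure: a short complex of `Cᵒᵖ` is a conflation if its opposite is. -/
def op (𝓔 : ExactStructure C) : ExactStructure Cᵒᵖ where
  conflation S := 𝓔.conflation S.unop
  conflation_of_iso e hS :=
    𝓔.conflation_of_iso ((ShortComplex.unopFunctor C).mapIso e).unop.symm hS
  isKernel S hS := (𝓔.isCokernel S.unop hS).map fun h => by
    exact CokernelCofork.IsColimit.ofπOp _ _ h
  isCokernel S hS := (𝓔.isKernel S.unop hS).map fun h => by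
    exact KernelFork.IsLimit.ofιOp _ _ h
  inflation_id A := isInflationFor_unop_iff.2 (𝓔.deflation_id A.unop)
  deflation_id A := isDeflationFor_unop_iff.2 (𝓔.inflation_id A.unop)
  inflation_comp i j hi hj := isInflationFor_unop_iff.2 <|
    𝓔.deflation_comp _ _ (isInflationFor_unop_iff.1 hj) (isInflationFor_unop_iff.1 hi)
  deflation_comp p q hp hq := isDeflationFor_unop_iff.2 <|
    𝓔.inflation_comp _ _ (isDeflationFor_unop_iff.1 hq) (isDeflationFor_unop_iff.1 hp)
  inflation_pushout i f hi := by
    obtain ⟨B', f', i', sq, hi'⟩ := 𝓔.deflation_pullback _ f.unop (isInflationFor_unop_iff.1 hi)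
    exact ⟨_, f'.op, i'.op, sq.op.flip, isInflationFor_unop_iff.2 hi'⟩
  deflation_pullback p f hp := by
    obtain ⟨B', f', p', sq, hp'⟩ := 𝓔.inflation_pushout _ f.unop (isDeflationFor_unop_iff.1 hp)
    exact ⟨_, f'.op, p'.op, sq.op.flip, isDeflationFor_unop_iff.2 hp'⟩

lemma IsConflation.op {A B Z : C} {i : A ⟶ B} {p : B ⟶ Z} (h : 𝓔.IsConflation i p) :
    𝓔.op.IsConflation p.op i.op :=
  ⟨congrArg Quiver.Hom.op h.1, h.2⟩

lemma IsConflation.unop {A B Z : Cᵒᵖ} {i : A ⟶ B} {p : B ⟶ Z} (h : 𝓔.op.IsConflation i p) :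
    𝓔.IsConflation p.unop i.unop :=
  ⟨congrArg Quiver.Hom.unop h.1, h.2⟩

namespace YonedaExtension

/-- The extension of `Y` by `X` obtained by splicing a conflation `X ⟶ E ⟶ Z` with an extension of
`Y` by `Z`. -/
def append {X E Z : C} (i : X ⟶ E) (p : E ⟶ Z) (h : 𝓔.IsConflation i p) :
    {n : ℕ} → {Y : C} → 𝓔.YonedaExtension Z (n + 1) Y → 𝓔.YonedaExtension X (n + 2) Y
  | _, _, .single j q k => .splice j q k (.single i p h)
  | _ + 1, _, .splice j q k ξ => .splice j q k (append i p h ξ)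

lemma HasMor.append {X E Z X' E' Z' : C} {i : X ⟶ E} {p : E ⟶ Z} (h : 𝓔.IsConflation i p)
    {i' : X' ⟶ E'} {p' : E' ⟶ Z'} (h' : 𝓔.IsConflation i' p') {α : X ⟶ X'} {γ : E ⟶ E'}
    {ζ : Z ⟶ Z'} (h₁ : i ≫ γ = α ≫ i') (h₂ : p ≫ ζ = γ ≫ p') :
    ∀ {n : ℕ} {Y Y' : C} {ξ : 𝓔.YonedaExtension Z (n + 1) Y}
      {ξ' : 𝓔.YonedaExtension Z' (n + 1) Y'} {β : Y ⟶ Y'}, HasMor ζ ξ ξ' β →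
      HasMor α (ξ.append i p h) (ξ'.append i' p' h') β
  | 0, _, _, .single _ _ _, .single _ _ _, _, H => by
    obtain ⟨δ, h₃, h₄⟩ := H
    exact ⟨ζ, δ, h₃, h₄, γ, h₁, h₂⟩
  | _ + 1, _, _, .splice _ _ _ _, .splice _ _ _ _, _, H => by
    obtain ⟨_, δ, h₃, h₄, H⟩ := H
    exact ⟨_, δ, h₃, h₄, H.append h h' h₁ h₂⟩

/-- The opposite of an extension of `Y` by `X`, an extension of `op X` by `op Y`. -/
def op {X : C} : {n : ℕ} → {Y : C} → 𝓔.YonedaExtension X n Y →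
    𝓔.op.YonedaExtension (.op Y) n (.op X)
  | _, _, .hom f => .hom f.op
  | _, _, .single i p h => .single p.op i.op h.op
  | _, _, .splice i p h ξ => append p.op i.op h.op ξ.op

/-- The extension in `C` underlying an extension in `Cᵒᵖ`, the inverse of `YonedaExtension.op`. -/
def unop {Y : Cᵒᵖ} : {n : ℕ} → {X : Cᵒᵖ} → 𝓔.op.YonedaExtension Y n X →
    𝓔.YonedaExtension X.unop n Y.unop
  | _, _, .hom f => .hom f.unop
  | _, _, .single i p h => .single p.unop i.unop h.unop
  | _, _, .splice i p h ξ => append p.unop i.unop h.unop ξ.unop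

lemma op_append {X E Z : C} {i : X ⟶ E} {p : E ⟶ Z} (h : 𝓔.IsConflation i p) :
    ∀ {n : ℕ} {Y : C} (ξ : 𝓔.YonedaExtension Z (n + 1) Y),
      (ξ.append i p h).op = .splice p.op i.op h.op ξ.op
  | _, _, .single _ _ _ => rfl
  | _ + 1, _, .splice j q k ξ => congrArg (append q.op j.op k.op) (op_append h ξ)

lemma unop_append {Y E Z : Cᵒᵖ} {i : Y ⟶ E} {p : E ⟶ Z} (h : 𝓔.op.IsConflation i p) :
    ∀ {n : ℕ} {X : Cᵒᵖ} (ξ : 𝓔.op.YonedaExtension Z (n + 1) X),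
      (ξ.append i p h).unop = .splice p.unop i.unop h.unop ξ.unop
  | _, _, .single _ _ _ => rfl
  | _ + 1, _, .splice j q k ξ => congrArg (append q.unop j.unop k.unop) (unop_append h ξ)

lemma unop_op {X : C} : ∀ {n : ℕ} {Y : C} (ξ : 𝓔.YonedaExtension X n Y), ξ.op.unop = ξ
  | _, _, .hom _ => rfl
  | _, _, .single _ _ _ => rfl
  | _, _, .splice i p h ξ => (unop_append h.op ξ.op).trans (congrArg (splice i p h) (unop_op ξ))

lemma op_unop {Y : Cᵒᵖ} : ∀ {n : ℕ} {X : Cᵒᵖ} (ξ : 𝓔.op.YonedaExtension Y n X), ξ.unop.op = ξ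
  | _, _, .hom _ => rfl
  | _, _, .single _ _ _ => rfl
  | _, _, .splice i p h ξ => (op_append h.unop ξ.unop).trans (congrArg (splice i p h) (op_unop ξ))

lemma HasMor.op {X X' : C} {α : X ⟶ X'} : ∀ {n : ℕ} {Y Y' : C} {ξ : 𝓔.YonedaExtension X n Y}
    {ξ' : 𝓔.YonedaExtension X' n Y'} {β : Y ⟶ Y'}, HasMor α ξ ξ' β → HasMor β.op ξ'.op ξ.op α.op
  | _, _, _, .hom _, .hom _, _, H => congrArg Quiver.Hom.op H.symm
  | _, _, _, .single _ _ _, .single _ _ _, _, H => by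
    obtain ⟨γ, h₁, h₂⟩ := H
    exact ⟨γ.op, congrArg Quiver.Hom.op h₂.symm, congrArg Quiver.Hom.op h₁.symm⟩
  | _, _, _, .splice _ _ h _, .splice _ _ h' _, _, H => by
    obtain ⟨_, _, h₁, h₂, H⟩ := H
    exact H.op.append h'.op h.op (congrArg Quiver.Hom.op h₂.symm) (congrArg Quiver.Hom.op h₁.symm)

lemma HasMor.unop {Y Y' : Cᵒᵖ} {β : Y ⟶ Y'} : ∀ {n : ℕ} {X X' : Cᵒᵖ}
    {ξ : 𝓔.op.YonedaExtension Y n X} {ξ' : 𝓔.op.YonedaExtension Y' n X'} {α : X ⟶ X'},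
    HasMor β ξ ξ' α → HasMor α.unop ξ'.unop ξ.unop β.unop
  | _, _, _, .hom _, .hom _, _, H => congrArg Quiver.Hom.unop H.symm
  | _, _, _, .single _ _ _, .single _ _ _, _, H => by
    obtain ⟨γ, h₁, h₂⟩ := H
    exact ⟨γ.unop, congrArg Quiver.Hom.unop h₂.symm, congrArg Quiver.Hom.unop h₁.symm⟩
  | _, _, _, .splice _ _ h _, .splice _ _ h' _, _, H => by
    obtain ⟨_, _, h₁, h₂, H⟩ := H
    exact H.unop.append h'.unop h.unop (congrArg Quiver.Hom.unop h₂.symm)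
        (congrArg Quiver.Hom.unop h₁.symm)

variable {A : Type u'} [Category.{v'} A] [Abelian A]

section

variable {F : C ⥤ A} [F.Additive] {X E Z : C} {i : X ⟶ E} {p : E ⟶ Z} (h : 𝓔.IsConflation i p)

lemma mapExact_append_iff : ∀ {n : ℕ} {Y : C} {ξ : 𝓔.YonedaExtension Z (n + 1) Y},
    (ξ.append i p h).MapExact F ↔
      ξ.MapExact F ∧ ((ShortComplex.mk i p h.zero).map F).ShortExact
  | _, _, .single _ _ _ => Iff.rfl
  | _ + 1, _, .splice _ _ _ _ => (and_congr_right' mapExact_append_iff).trans and_assoc.symm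

lemma mapClass_append [HasExt.{w} A] (hS : ((ShortComplex.mk i p h.zero).map F).ShortExact) :
    ∀ {n : ℕ} {Y : C} (ξ : 𝓔.YonedaExtension Z (n + 1) Y) (hξ : ξ.MapExact F),
    (ξ.append i p h).mapClass F ((mapExact_append_iff h).2 ⟨hξ, hS⟩) =
      (ξ.mapClass F hξ).comp (mapExtClass F h hS) rfl
  | _, _, .single _ _ _, _ => rfl
  | n + 1, _, .splice j q k ξ, hξ => by
    have := mapClass_append hS ξ hξ.2
    rw [mapClass_splice k ξ hξ,
      Abelian.Ext.comp_assoc _ _ _ (add_comm 1 (n + 1)) rfl (by lia), ← this]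
    rfl

end

variable {G : Cᵒᵖ ⥤ A} [G.Additive] {X : C}

lemma mapExact_op_iff : ∀ {n : ℕ} {Y : C} {ξ : 𝓔.YonedaExtension X n Y},
    ξ.op.MapExact G ↔ ξ.OpMapExact G
  | _, _, .hom _ => Iff.rfl
  | _, _, .single _ _ _ => Iff.rfl
  | _, _, .splice _ _ h _ =>
    (mapExact_append_iff h.op).trans (and_comm.trans (and_congr_right' mapExact_op_iff))

lemma mapClass_op [HasExt.{w} A] : ∀ {n : ℕ} {Y : C} (ξ : 𝓔.YonedaExtension X n Y)
    (hξ : ξ.OpMapExact G), ξ.op.mapClass G (mapExact_op_iff.2 hξ) = ξ.opMapClass G hξ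
  | _, _, .hom _, _ => rfl
  | _, _, .single _ _ _, _ => rfl
  | _, _, .splice _ _ h ξ, hξ =>
    (mapClass_append h.op hξ.1 ξ.op (mapExact_op_iff.2 hξ.2)).trans
      (congrArg (fun y => Abelian.Ext.comp y (mapExtClass G h.op hξ.1) rfl) (mapClass_op ξ hξ.2))

end YonedaExtension

namespace Ext

variable {n : ℕ}

/-- Taking opposites of extensions, as a map `Extⁿ(Y, X) → Extⁿ(op X, op Y)`. -/
def op {X Y : C} : 𝓔.Ext n Y X → 𝓔.op.Ext n (.op X) (.op Y) :=
  Quot.lift (fun ξ => mk ξ.op) fun _ _ H => (mk_eq H.op).symm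

/-- The inverse of `Ext.op`. -/
def unop {X Y : Cᵒᵖ} : 𝓔.op.Ext n X Y → 𝓔.Ext n Y.unop X.unop :=
  Quot.lift (fun ξ => mk ξ.unop) fun _ _ H => (mk_eq H.unop).symm

lemma op_push {X X' Y : C} (α : X ⟶ X') (x : 𝓔.Ext n Y X) :
    (push α x).op = pull α.op x.op := by
  obtain ⟨ξ, rfl⟩ := exists_mk x
  obtain ⟨η, hη, H⟩ := exists_push_mk α ξ
  rw [hη]
  exact (pull_mk_eq H.op).symm

lemma op_pull {X Y Y' : C} (β : Y' ⟶ Y) (x : 𝓔.Ext n Y X) :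
    (pull β x).op = push β.op x.op := by
  obtain ⟨ξ, rfl⟩ := exists_mk x
  obtain ⟨η, hη, H⟩ := exists_pull_mk β ξ
  rw [hη]
  exact (push_mk_eq H.op).symm

/-- `Ext.op` as a bijection. -/
def opEquiv (Y X : C) : 𝓔.Ext n Y X ≃ 𝓔.op.Ext n (.op X) (.op Y) where
  toFun := op
  invFun := unop
  left_inv := by
    rintro ⟨ξ⟩
    exact congrArg mk ξ.unop_op
  right_inv := by
    rintro ⟨ξ⟩
    exact congrArg mk ξ.op_unop

variable [HasZeroObject C] [HasBinaryBiproducts C]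

/-- The isomorphism `Extⁿ(Y, X) ≃ Extⁿ(op X, op Y)` given by taking opposites of extensions. -/
noncomputable def opAddEquiv (Y X : C) : 𝓔.Ext n Y X ≃+ 𝓔.op.Ext n (.op X) (.op Y) :=
  AddEquiv.mk' (opEquiv Y X)
    (map_add_of_natural (T := fun _ => op) (fun α α' => pull_add_pull α.op α'.op) op_push)

end Ext

end ExactStructure
end

section
variable {C : Type u} [Category.{v} C] [Preadditive C] {𝓔 : ExactStructure C}
  {M : ObjectProperty C} {X Y : C} {k : ℕ}

namespace ExactStructure

open YonedaExtension

lemma exact_comp_op {A B D N : C} {a : A ⟶ B} {b : B ⟶ D}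
    (h : Function.Exact (fun g : D ⟶ N => b ≫ g) (fun g : B ⟶ N => a ≫ g)) :
    Function.Exact (fun g : Opposite.op N ⟶ .op D => g ≫ b.op)
      (fun g : Opposite.op N ⟶ .op B => g ≫ a.op) := fun g => by
  constructor
  · intro hg
    obtain ⟨f, hf⟩ := (h g.unop).1 (congrArg Quiver.Hom.unop hg)
    exact ⟨f.op, congrArg Quiver.Hom.op hf⟩
  · rintro ⟨f, rfl⟩
    exact congrArg Quiver.Hom.op (h.apply_apply_eq_zero f.unop)

lemma gen_op_of_cogen (hX : 𝓔.cogen M k X) : 𝓔.op.gen M.op k (.op X) := by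
  obtain ⟨Z, M', ι, π, rfl, hc, hex⟩ := hX
  refine ⟨fun j => .op (Z j), fun j => .op (M' j), fun j => (π j).op, fun j => (ι j).op, rfl,
    fun j hj => ⟨(hc j hj).1, (hc j hj).2.op⟩, fun N hN => ?_⟩
  obtain ⟨h₀, h₁, h₂⟩ := hex N.unop hN
  refine ⟨fun g => ?_, fun hk => exact_comp_op (h₁ hk), fun j hj => exact_comp_op (h₂ j hj)⟩
  obtain ⟨f, hf⟩ := h₀ g.unop
  exact ⟨f.op, congrArg Quiver.Hom.op hf⟩

lemma isImageClass_op_iff {A : Type u'} [Category.{v'} A] [Abelian A] [HasExt.{w} A]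
    {G : Cᵒᵖ ⥤ A} [G.Additive] {n : ℕ} {x : 𝓔.Ext n Y X}
    {y : Abelian.Ext.{w} (G.obj (.op X)) (G.obj (.op Y)) n} :
    IsImageClass G x.op y ↔
      ∃ (ξ : 𝓔.YonedaExtension X n Y) (hξ : ξ.OpMapExact G),
        Ext.mk ξ = x ∧ ξ.opMapClass G hξ = y := by
  constructor
  · rintro ⟨ξ, hξ, hx, rfl⟩
    obtain ⟨ξ, rfl⟩ : ∃ η : 𝓔.YonedaExtension X n Y, η.op = ξ := ⟨ξ.unop, ξ.op_unop⟩
    exact ⟨ξ, mapExact_op_iff.1 hξ, (Ext.opEquiv Y X).injective hx, (mapClass_op ξ _).symm⟩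
  · rintro ⟨ξ, hξ, rfl, rfl⟩
    exact ⟨ξ.op, mapExact_op_iff.2 hξ, rfl, mapClass_op ξ hξ⟩

variable [HasZeroObject C] [HasBinaryBiproducts C]

lemma rightExtOrthogonal_op_of_leftExtOrthogonal (hY : 𝓔.leftExtOrthogonal M k Y) :
    𝓔.op.rightExtOrthogonal M.op k (.op Y) := fun i hi hik N hN x => by
  obtain ⟨x, rfl⟩ := (Ext.opAddEquiv Y N.unop).surjective x
  rw [hY i hi hik N.unop hN x, map_zero]

end ExactStructure
end

namespace AddModule

section
variable {A : Type u} [Category.{v} A] [Preadditive A]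

/-- The component of a morphism of additive functors as a group homomorphism. -/
def eval {F G : A ⥤+ AddCommGrpCat.{v}} (f : F ⟶ G) (a : A) : F.obj.obj a →+ G.obj.obj a :=
  (f.hom.app a).hom

lemma hom_ext {F G : A ⥤+ AddCommGrpCat.{v}} {f g : F ⟶ G}
    (h : ∀ a x, eval f a x = eval g a x) : f = g := by
  ext a x
  exact h a x

lemma eval_comp {F G H : A ⥤+ AddCommGrpCat.{v}} (f : F ⟶ G) (g : G ⟶ H) (a : A)
    (x : F.obj.obj a) : eval (f ≫ g) a x = eval g a (eval f a x) := rfl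

lemma eval_naturality {F G : A ⥤+ AddCommGrpCat.{v}} (f : F ⟶ G) {a b : A} (u : a ⟶ b)
    (x : F.obj.obj a) : eval f b ((F.obj.map u).hom x) = (G.obj.map u).hom (eval f a x) :=
  congr($(f.hom.naturality u) x)

lemma eval_surjective_of_epi {F G : A ⥤+ AddCommGrpCat.{v}} (f : F ⟶ G) [Epi f] (a : A) :
    Function.Surjective (eval f a) := by
  have := (additiveFunctor A AddCommGrpCat.{v}).preservesEpimorphisms_ι_of_isNormalMonoCategory
  have h : Epi ((additiveFunctor A AddCommGrpCat.{v}).ι.map f) := inferInstance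
  have h' : Epi f.hom := h
  have := (NatTrans.epi_iff_epi_app f.hom).1 h' a
  exact (AddCommGrpCat.epi_iff_surjective _).1 this

lemma epi_of_eval_surjective {F G : A ⥤+ AddCommGrpCat.{v}} (f : F ⟶ G)
    (h : ∀ a : A, Function.Surjective (eval f a)) : Epi f := by
  refine ⟨fun g g' e => hom_ext fun a y => ?_⟩
  obtain ⟨x, rfl⟩ := h a y
  rw [← eval_comp, e, eval_comp]

lemma mono_of_eval_injective {F G : A ⥤+ AddCommGrpCat.{v}} (f : F ⟶ G)
    (h : ∀ a : A, Function.Injective (eval f a)) : Mono f :=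
  ⟨fun g g' e => hom_ext fun a y => h a (by rw [← eval_comp, e, eval_comp])⟩

lemma shortExact_of_eval {S : ShortComplex (A ⥤+ AddCommGrpCat.{v})}
    (hf : ∀ a : A, Function.Injective (eval S.f a))
    (hfg : ∀ (a : A) (y : S.X₂.obj.obj a), eval S.g a y = 0 → ∃ x, eval S.f a x = y)
    (hg : ∀ a : A, Function.Surjective (eval S.g a)) : S.ShortExact := by
  have := mono_of_eval_injective S.f hf
  have := epi_of_eval_surjective S.g hg
  refine { exact := ?_ }
  refine S.exact_of_f_is_kernel (KernelFork.IsLimit.ofι' _ _ fun {T} k hk => ?_)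
  have hk' : ∀ a (t : T.obj.obj a), eval S.g a (eval k a t) = 0 := fun a t => by
    rw [← eval_comp, hk]; rfl
  choose l hl using fun a t => hfg a _ (hk' a t)
  refine ⟨⟨{ app := fun a => AddCommGrpCat.ofHom (AddMonoidHom.mk' (l a) fun x y => hf a ?_)
             naturality := fun a b u => ?_ }⟩, ?_⟩
  · rw [hl, map_add, map_add, hl, hl]
  · ext t
    refine hf b ?_
    change eval S.f b (l b ((T.obj.map u).hom t)) = eval S.f b ((S.X₁.obj.map u).hom (l a t))
    rw [hl, eval_naturality, eval_naturality, hl]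
  · exact hom_ext fun a t => hl a t

end

section
variable {A : Type u} [Category.{v} A] [Preadditive A] {P Q : A ⥤+ AddCommGrpCat.{v}} {a : A}
  {u : P.obj.obj a}

/-- The element `u` of `P a` is universal if `g ↦ P g u` identifies the morphisms `a ⟶ b` with the
elements of `P b`, so that `P` is corepresented by `a`. -/
def IsUniversalElement (u : P.obj.obj a) : Prop :=
  ∀ b, Function.Bijective fun g : a ⟶ b => (P.obj.map g).hom u

namespace IsUniversalElement

variable (hu : IsUniversalElement u)
include hu

lemma exists_hom (q : Q.obj.obj a) : ∃ f : P ⟶ Q, eval f a u = q := by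
  choose l hl using fun b => (hu b).2
  have eq_l : ∀ {b x} (g : a ⟶ b), (P.obj.map g).hom u = x → l b x = g := fun g hg =>
    (hu _).1 ((hl _ _).trans hg.symm)
  have l_add : ∀ b x y, l b (x + y) = l b x + l b y := fun b x y => eq_l _ <| by
    rw [P.obj.map_add]
    exact congrArg₂ (· + ·) (hl b x) (hl b y)
  have l_map : ∀ {b c} (w : b ⟶ c) x, l c ((P.obj.map w).hom x) = l b x ≫ w := fun w x =>
    eq_l _ <| by
      rw [P.obj.map_comp]
      exact congrArg (P.obj.map w).hom (hl _ x)
  refine ⟨⟨{ app := fun b => AddCommGrpCat.ofHom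
               (AddMonoidHom.mk' (fun x => (Q.obj.map (l b x)).hom q) fun x y => ?_)
             naturality := fun b c w => ?_ }⟩, ?_⟩
  · rw [l_add, Q.obj.map_add]
    rfl
  · ext x
    change (Q.obj.map (l c ((P.obj.map w).hom x))).hom q = _
    rw [l_map, Q.obj.map_comp]
    rfl
  · change (Q.obj.map (l a u)).hom q = q
    rw [eq_l (𝟙 a) (by rw [P.obj.map_id]; rfl), Q.obj.map_id]
    rfl

lemma eval_bijective : Function.Bijective fun f : P ⟶ Q => eval f a u := by
  refine ⟨fun f f' h => hom_ext fun b x => ?_, hu.exists_hom⟩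
  obtain ⟨g, rfl⟩ := (hu b).2 x
  simp only [eval_naturality]
  exact congrArg _ h

lemma projective : Projective P := by
  refine ⟨fun f g _ => ?_⟩
  obtain ⟨q, hq⟩ := eval_surjective_of_epi g a (eval f a u)
  obtain ⟨f', rfl⟩ := hu.eval_bijective.2 q
  exact ⟨f', hu.eval_bijective.1 hq⟩

end IsUniversalElement

end

end AddModule

section
variable {C : Type u} [Category.{v} C] [Preadditive C] {𝓔 : ExactStructure C}
  {M : ObjectProperty C}

lemma isUniversalElement_phi_id {N : C} (hN : M N) :
    AddModule.IsUniversalElement (P := (phi M).obj N) (a := .op ⟨N, hN⟩) (𝟙 N) := by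
  have map_id := fun b (g : (.op ⟨N, hN⟩ : M.FullSubcategoryᵒᵖ) ⟶ b) =>
    show (((phi M).obj N).obj.map g).hom (𝟙 N) = g.unop.hom from Category.comp_id g.unop.hom
  exact fun b => ⟨fun g g' h => Quiver.Hom.unop_inj <| ObjectProperty.hom_ext _ <|
      (map_id b g).symm.trans (h.trans (map_id b g')),
    fun g => ⟨(ObjectProperty.homMk g).op, map_id b _⟩⟩

lemma isUniversalElement_psi_id {N : C} (hN : M N) :
    AddModule.IsUniversalElement (P := (psi M).obj (.op N)) (a := ⟨N, hN⟩) (𝟙 N) := by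
  have map_id := fun b (g : (⟨N, hN⟩ : M.FullSubcategory) ⟶ b) =>
    show (((psi M).obj (.op N)).obj.map g).hom (𝟙 N) = g.hom from Category.id_comp g.hom
  exact fun b => ⟨fun g g' h => ObjectProperty.hom_ext _ <|
      (map_id b g).symm.trans (h.trans (map_id b g')),
    fun g => ⟨ObjectProperty.homMk g, map_id b _⟩⟩

namespace ExactStructure

variable (𝓔 M)

lemma isRestrictedYoneda_phi : IsRestrictedYoneda 𝓔 M (phi M) where
  map_bijective {N} hN Y := by
    have eval_map : Function.Bijective fun f : N ⟶ Y => 𝟙 N ≫ f := by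
      simp only [Category.id_comp]
      exact Function.bijective_id
    exact ((isUniversalElement_phi_id hN).eval_bijective.of_comp_iff' _).1 eval_map
  projective hN := (isUniversalElement_phi_id hN).projective
  shortExact h hp := by
    have := h.mono
    exact AddModule.shortExact_of_eval (fun N g g' e => (cancel_mono _).1 e)
      (fun N g e => h.exists_lift g e) (fun N => hp N.unop.obj N.unop.property)

lemma isRestrictedYoneda_psi : IsRestrictedYoneda 𝓔.op M.op (psi M) where
  map_bijective {N} hN Y := by
    have eval_map : Function.Bijective fun f : N ⟶ Y => f.unop ≫ 𝟙 N.unop := by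
      simp only [Category.comp_id]
      exact Quiver.Hom.opEquiv.symm.bijective
    exact ((isUniversalElement_psi_id (N := N.unop) hN).eval_bijective.of_comp_iff' _).1 eval_map
  projective {N} hN := (isUniversalElement_psi_id (N := N.unop) hN).projective
  shortExact h hp := by
    have := h.unop.epi
    exact AddModule.shortExact_of_eval (fun N g g' e => (cancel_epi _).1 e)
      (fun N g e => h.unop.exists_desc g e) (fun N g => by
        obtain ⟨l, hl⟩ := hp (.op N.obj) N.property g.op
        exact ⟨l.unop, congrArg Quiver.Hom.unop hl⟩)

end ExactStructure
end

section
variable {C : Type u} [Category.{v} C] [Preadditive C] [HasZeroObject C] [HasBinaryBiproducts C]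
  {𝓔 : ExactStructure C} {M : ObjectProperty C} {i k : ℕ} {X Y : C}

namespace ExactStructure

lemma inducesExtIso_phi (hi : i < k) (hX : 𝓔.rightExtOrthogonal M k X) (hY : 𝓔.gen M k Y) :
    InducesExtIso.{max u (v + 1)} 𝓔 (phi M) i Y X :=
  (isRestrictedYoneda_phi 𝓔 M).inducesExtIso (hasResolution_of_gen hY (by lia))
    (rightExtOrthogonal_anti hi hX)

lemma inducesExtIso_psi (hi : i < k) (hX : 𝓔.cogen M k X) (hY : 𝓔.leftExtOrthogonal M k Y) :
    InducesExtIso.{max u (v + 1)} 𝓔.op (psi M) i (.op X) (.op Y) :=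
  (isRestrictedYoneda_psi 𝓔 M).inducesExtIso (hasResolution_of_gen (gen_op_of_cogen hX) (by lia))
    (rightExtOrthogonal_anti hi (rightExtOrthogonal_op_of_leftExtOrthogonal hY))

end ExactStructure
end

open ExactStructure in
theorem mainTheorem6_general {C : Type u} [Category.{v} C] [Preadditive C] [HasZeroObject C]
    [HasBinaryBiproducts C] (𝓔 : ExactStructure C) (M : ObjectProperty C)
    (k : ℕ) :
    (∃ φ : ∀ (i : ℕ) (_ : i < k) (X Y : C) (_ : 𝓔.cogen M k X) (_ : 𝓔.leftExtOrthogonal M k Y),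
        𝓔.Ext i Y X ≃+ Abelian.Ext.{max u (v + 1)}
          ((psi M).obj (Opposite.op X)) ((psi M).obj (Opposite.op Y)) i,
      (∀ (i : ℕ) (hi : i < k) (X Y : C) (hX : 𝓔.cogen M k X) (hY : 𝓔.leftExtOrthogonal M k Y)
        (x : 𝓔.Ext i Y X)
        (y : Abelian.Ext.{max u (v + 1)}
          ((psi M).obj (Opposite.op X)) ((psi M).obj (Opposite.op Y)) i),
        φ i hi X Y hX hY x = y ↔
          ∃ (ξ : 𝓔.YonedaExtension X i Y) (hξ : ξ.OpMapExact (psi M)),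
            ExactStructure.Ext.mk ξ = x ∧ ξ.opMapClass (psi M) hξ = y) ∧
      (∀ (i : ℕ) (hi : i < k) (X X' Y : C) (hX : 𝓔.cogen M k X) (hX' : 𝓔.cogen M k X')
        (hY : 𝓔.leftExtOrthogonal M k Y) (f : X ⟶ X') (x : 𝓔.Ext i Y X),
        φ i hi X' Y hX' hY (ExactStructure.Ext.push f x) =
          (Abelian.Ext.mk₀ ((psi M).map f.op)).comp (φ i hi X Y hX hY x) (zero_add i)) ∧
      (∀ (i : ℕ) (hi : i < k) (X Y Y' : C) (hX : 𝓔.cogen M k X)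
        (hY : 𝓔.leftExtOrthogonal M k Y) (hY' : 𝓔.leftExtOrthogonal M k Y')
        (g : Y' ⟶ Y) (x : 𝓔.Ext i Y X),
        φ i hi X Y' hX hY' (ExactStructure.Ext.pull g x) =
          (φ i hi X Y hX hY x).comp (Abelian.Ext.mk₀ ((psi M).map g.op)) (add_zero i))) ∧
    (∃ φ : ∀ (i : ℕ) (_ : i < k) (X Y : C) (_ : 𝓔.rightExtOrthogonal M k X) (_ : 𝓔.gen M k Y),
        𝓔.Ext i Y X ≃+ Abelian.Ext.{max u (v + 1)} ((phi M).obj Y) ((phi M).obj X) i,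
      (∀ (i : ℕ) (hi : i < k) (X Y : C) (hX : 𝓔.rightExtOrthogonal M k X) (hY : 𝓔.gen M k Y)
        (x : 𝓔.Ext i Y X)
        (y : Abelian.Ext.{max u (v + 1)} ((phi M).obj Y) ((phi M).obj X) i),
        φ i hi X Y hX hY x = y ↔
          ∃ (ξ : 𝓔.YonedaExtension X i Y) (hξ : ξ.MapExact (phi M)),
            ExactStructure.Ext.mk ξ = x ∧ ξ.mapClass (phi M) hξ = y) ∧
      (∀ (i : ℕ) (hi : i < k) (X X' Y : C) (hX : 𝓔.rightExtOrthogonal M k X)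
        (hX' : 𝓔.rightExtOrthogonal M k X') (hY : 𝓔.gen M k Y) (f : X ⟶ X') (x : 𝓔.Ext i Y X),
        φ i hi X' Y hX' hY (ExactStructure.Ext.push f x) =
          (φ i hi X Y hX hY x).comp (Abelian.Ext.mk₀ ((phi M).map f)) (add_zero i)) ∧
      (∀ (i : ℕ) (hi : i < k) (X Y Y' : C) (hX : 𝓔.rightExtOrthogonal M k X)
        (hY : 𝓔.gen M k Y) (hY' : 𝓔.gen M k Y') (g : Y' ⟶ Y) (x : 𝓔.Ext i Y X),
        φ i hi X Y' hX hY' (ExactStructure.Ext.pull g x) =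
          (Abelian.Ext.mk₀ ((phi M).map g)).comp (φ i hi X Y hX hY x) (zero_add i))) := by
  constructor
  · have hF := isRestrictedYoneda_psi 𝓔 M
    choose φ hφ using fun (i : ℕ) (hi : i < k) (X Y : C) (hX : 𝓔.cogen M k X)
      (hY : 𝓔.leftExtOrthogonal M k Y) => inducesExtIso_psi hi hX hY
    refine ⟨fun i hi X Y hX hY => (Ext.opAddEquiv Y X).trans (φ i hi X Y hX hY),
      fun i hi X Y hX hY x y => (hφ i hi X Y hX hY x.op y).trans isImageClass_op_iff,
      fun i hi X X' Y hX hX' hY f x => (hφ i hi X' Y hX' hY (Ext.push f x).op _).2 ?_,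
      fun i hi X Y Y' hX hY hY' g x => (hφ i hi X Y' hX hY' (Ext.pull g x).op _).2 ?_⟩
    · rw [Ext.op_push]
      exact ((hφ i hi X Y hX hY x.op _).1 rfl).pull hF f.op
    · rw [Ext.op_pull]
      exact ((hφ i hi X Y hX hY x.op _).1 rfl).push hF g.op
  · have hF := isRestrictedYoneda_phi 𝓔 M
    choose φ hφ using fun (i : ℕ) (hi : i < k) (X Y : C) (hX : 𝓔.rightExtOrthogonal M k X)
      (hY : 𝓔.gen M k Y) => inducesExtIso_phi hi hX hY
    exact ⟨φ, hφ,
      fun i hi X X' Y hX hX' hY f x => (hφ i hi X' Y hX' hY _ _).2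
        (((hφ i hi X Y hX hY x _).1 rfl).push hF f),
      fun i hi X Y Y' hX hY hY' g x => (hφ i hi X Y' hX hY' _ _).2
        (((hφ i hi X Y hX hY x _).1 rfl).pull hF g)⟩

theorem mainTheorem6 {C : Type u} [Category.{v} C] [Preadditive C] [HasZeroObject C]
    [HasBinaryBiproducts C] (𝓔 : ExactStructure C) (M : ObjectProperty C)
    [HasZeroObject M.FullSubcategory] [HasBinaryBiproducts M.FullSubcategory]
    (k : ℕ) (hk : 1 ≤ k) :
    (∃ φ : ∀ (i : ℕ) (_ : i < k) (X Y : C) (_ : 𝓔.cogen M k X) (_ : 𝓔.leftExtOrthogonal M k Y),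
        𝓔.Ext i Y X ≃+ Abelian.Ext.{max u (v + 1)}
          ((psi M).obj (Opposite.op X)) ((psi M).obj (Opposite.op Y)) i,
      -- `φ` is induced by `Ψ`: every class is represented by an extension whose image under `Ψ`
      -- is exact, and it is sent to the class of the image of any such extension
      (∀ (i : ℕ) (hi : i < k) (X Y : C) (hX : 𝓔.cogen M k X) (hY : 𝓔.leftExtOrthogonal M k Y)
        (x : 𝓔.Ext i Y X)
        (y : Abelian.Ext.{max u (v + 1)}
          ((psi M).obj (Opposite.op X)) ((psi M).obj (Opposite.op Y)) i),
        φ i hi X Y hX hY x = y ↔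
          ∃ (ξ : 𝓔.YonedaExtension X i Y) (hξ : ξ.OpMapExact (psi M)),
            ExactStructure.Ext.mk ξ = x ∧ ξ.opMapClass (psi M) hξ = y) ∧
      -- `φ` is natural in `X`
      (∀ (i : ℕ) (hi : i < k) (X X' Y : C) (hX : 𝓔.cogen M k X) (hX' : 𝓔.cogen M k X')
        (hY : 𝓔.leftExtOrthogonal M k Y) (f : X ⟶ X') (x : 𝓔.Ext i Y X),
        φ i hi X' Y hX' hY (ExactStructure.Ext.push f x) =
          (Abelian.Ext.mk₀ ((psi M).map f.op)).comp (φ i hi X Y hX hY x) (zero_add i)) ∧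
      -- `φ` is natural in `Y`
      (∀ (i : ℕ) (hi : i < k) (X Y Y' : C) (hX : 𝓔.cogen M k X)
        (hY : 𝓔.leftExtOrthogonal M k Y) (hY' : 𝓔.leftExtOrthogonal M k Y')
        (g : Y' ⟶ Y) (x : 𝓔.Ext i Y X),
        φ i hi X Y' hX hY' (ExactStructure.Ext.pull g x) =
          (φ i hi X Y hX hY x).comp (Abelian.Ext.mk₀ ((psi M).map g.op)) (add_zero i))) ∧
    (∃ φ : ∀ (i : ℕ) (_ : i < k) (X Y : C) (_ : 𝓔.rightExtOrthogonal M k X) (_ : 𝓔.gen M k Y),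
        𝓔.Ext i Y X ≃+ Abelian.Ext.{max u (v + 1)} ((phi M).obj Y) ((phi M).obj X) i,
      -- `φ` is induced by `Φ`
      (∀ (i : ℕ) (hi : i < k) (X Y : C) (hX : 𝓔.rightExtOrthogonal M k X) (hY : 𝓔.gen M k Y)
        (x : 𝓔.Ext i Y X)
        (y : Abelian.Ext.{max u (v + 1)} ((phi M).obj Y) ((phi M).obj X) i),
        φ i hi X Y hX hY x = y ↔
          ∃ (ξ : 𝓔.YonedaExtension X i Y) (hξ : ξ.MapExact (phi M)),
            ExactStructure.Ext.mk ξ = x ∧ ξ.mapClass (phi M) hξ = y) ∧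
      -- `φ` is natural in `X`
      (∀ (i : ℕ) (hi : i < k) (X X' Y : C) (hX : 𝓔.rightExtOrthogonal M k X)
        (hX' : 𝓔.rightExtOrthogonal M k X') (hY : 𝓔.gen M k Y) (f : X ⟶ X') (x : 𝓔.Ext i Y X),
        φ i hi X' Y hX' hY (ExactStructure.Ext.push f x) =
          (φ i hi X Y hX hY x).comp (Abelian.Ext.mk₀ ((phi M).map f)) (add_zero i)) ∧
      -- `φ` is natural in `Y`
      (∀ (i : ℕ) (hi : i < k) (X Y Y' : C) (hX : 𝓔.rightExtOrthogonal M k X)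
        (hY : 𝓔.gen M k Y) (hY' : 𝓔.gen M k Y') (g : Y' ⟶ Y) (x : 𝓔.Ext i Y X),
        φ i hi X Y' hX hY' (ExactStructure.Ext.pull g x) =
          (Abelian.Ext.mk₀ ((phi M).map g)).comp (φ i hi X Y hX hY x) (zero_add i))) :=
  mainTheorem6_general 𝓔 M k
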